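/- Let $B\subset\mathbb R^d$ be a bounded Borel set of positive Lebesgue measure, let $\mathbf N$ be the space of integer-valued finite measures on $B$, with the smallest $\sigma$-algebra making all maps $x\mapsto x(A)$ ($A\subset B$ Borel) measurable, and let $\eta$ be a Poisson point process on $B$ whose intensity measure $\lambda$ is finite and has no atoms; let $P_\eta$ be its law on $\mathbf N$. Let $\mu$ be a finite point process on $B$ whose law has a measurable density $p:\mathbf N\to[0,\infty)$, $\int p\,dP_\eta=1$, with respect to $P_\eta$. A $U$-statistic of order $k$ is a functional $$F(x)=\sum_{(x_1,\dots,x_k)\in x^k_{\neq}}f(x_1,\dots,x_k),\qquad x\in\mathbf N,$$ where $f:B^k\to\mathbb R$ is symmetric, $f\in L_1(\lambda^k)$, and $x^k_{\neq}$ is the set of $k$-tuples of pairwise different points of $x$. For $F:\mathbf N\to\mathbb R$ and $y_1,\dots,y_n\in B$ let $D_{y}F(x)=F(x+\delta_y)-F(x)$, $D^0F=F$, $D^n_{y_1,\dots,y_n}F=D_{y_1}D^{n-1}_{y_2,\dots,y_n}F$, and $T_nF(y_1,\dots,y_n)=\mathbb E\,D^n_{y_1,\dots,y_n}F(\eta)$.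 Theorem 1. Let $F_j$ be $U$-statistics of orders $k_j$, $j=1,\dots,m$, such that $\prod_{j=1}^mF_j\in L_2(P_\eta)$, let $p\in L_2(P_\eta)$, and put $q=\sum_{j=1}^mk_j$. Then $\prod_jF_j(\mu)$ and $\prod_jF_j(\eta)$ are integrable; for $1\le n\le q$ the expectations defining $T_n\prod_jF_j$ and $T_np$ exist $\lambda^n$-almost everywhere and define elements of $L_2(\lambda^n)$; and $$\mathbb E\Big[\prod_{j=1}^mF_j(\mu)\Big]=\mathbb E\Big[\prod_{j=1}^mF_j(\eta)\Big]+\sum_{n=1}^{q}\frac1{n!}\Big\langle T_n\prod_{j=1}^mF_j,\;T_np\Big\rangle_n,$$ where $\langle\cdot,\cdot\rangle_n$ is the scalar product of $L_2(\lambda^n)$. -/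

import Mathlib

open MeasureTheory ProbabilityTheory
open scoped NNReal ENNReal

namespace PoissonFunctionals

/-- The space `𝐍` of integer-valued finite measures on `X`. Taking `A = Set.univ` shows that such
a measure is finite. -/
def Config (X : Type*) [MeasurableSpace X] : Type _ :=
  {x : Measure X // ∀ A : Set X, MeasurableSet A → ∃ n : ℕ, x A = n}

/-- The smallest σ-algebra on `𝐍` that makes all the maps `x ↦ x A`, `A` measurable, measurable:
the trace of Mathlib's σ-algebra on `Measure X`, which is defined in this way. -/
instance Config.instMeasurableSpace (X : Type*) [MeasurableSpace X] :
    MeasurableSpace (Config X) :=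
  inferInstanceAs (MeasurableSpace
    {x : Measure X // ∀ A : Set X, MeasurableSet A → ∃ n : ℕ, x A = n})

/-- The configuration `x + δ_y`. -/
noncomputable def Config.addPoint {X : Type*} [MeasurableSpace X] (x : Config X) (y : X) :
    Config X :=
  ⟨x.1 + Measure.dirac y, fun A hA => by
    obtain ⟨n, hn⟩ := x.2 A hA
    by_cases h : y ∈ A
    · exact ⟨n + 1, by simp [hn, Measure.dirac_apply' y hA, h]⟩
    · exact ⟨n, by simp [hn, Measure.dirac_apply' y hA, h]⟩⟩

/-- The set of points of a configuration. -/
def Config.points {X : Type*} [MeasurableSpace X] (x : Config X) : Set X :=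
  {y | x.1 {y} ≠ 0}

/-- The set `x^k_≠` of `k`-tuples of different points of the configuration `x`. -/
def Config.tuples {X : Type*} [MeasurableSpace X] (k : ℕ) (x : Config X) : Set (Fin k → X) :=
  {t | Function.Injective t ∧ ∀ i, t i ∈ x.points}

theorem Config.finite_points {X : Type*} [MeasurableSpace X] [MeasurableSingletonClass X]
    (x : Config X) : x.points.Finite := by
  by_contra h
  obtain ⟨n, hn⟩ := x.2 Set.univ MeasurableSet.univ
  obtain ⟨s, hs, hc⟩ := Set.Infinite.exists_subset_card_eq h (n + 1)
  have h1 : ∀ y ∈ s, (1 : ℝ≥0∞) ≤ x.1 {y} := by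
    intro y hy
    obtain ⟨a, ha⟩ := x.2 {y} (measurableSet_singleton y)
    have h0 : x.1 {y} ≠ 0 := hs hy
    rw [ha] at h0 ⊢
    have : a ≠ 0 := by exact_mod_cast h0
    exact_mod_cast Nat.one_le_iff_ne_zero.mpr this
  have h2 : ((n + 1 : ℕ) : ℝ≥0∞) ≤ n := by
    calc ((n + 1 : ℕ) : ℝ≥0∞) = ∑ _y ∈ s, (1 : ℝ≥0∞) := by simp [hc]
      _ ≤ ∑ y ∈ s, x.1 {y} := Finset.sum_le_sum h1
      _ = x.1 s := sum_measure_singleton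
      _ ≤ x.1 Set.univ := measure_mono (Set.subset_univ _)
      _ = n := hn
  have : n + 1 ≤ n := by exact_mod_cast h2
  omega

/-- The sum in the definition of a `U`-statistic below is a finite sum. -/
theorem Config.finite_tuples {X : Type*} [MeasurableSpace X] [MeasurableSingletonClass X]
    (k : ℕ) (x : Config X) : (x.tuples k).Finite :=
  (Set.Finite.pi' fun _ : Fin k => x.finite_points).subset fun _ ht => ht.2

/-- `F` is a `U`-statistic of order `k`: the functional
`F(x) = ∑ f(x₁, …, x_k)`, summed over all `k`-tuples of different points of `x`,
with a symmetric `f ∈ L₁(ν^k)`. -/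
def IsUStatistic {X : Type*} [MeasurableSpace X] (ν : Measure X) (k : ℕ)
    (F : Config X → ℝ) : Prop :=
  ∃ f : (Fin k → X) → ℝ, Measurable f ∧
    (∀ (σ : Equiv.Perm (Fin k)) (t : Fin k → X), f (t ∘ σ) = f t) ∧
    Integrable f (Measure.pi fun _ : Fin k => ν) ∧
    ∀ x : Config X, F x = ∑ᶠ t ∈ x.tuples k, f t

/-- The random element `η` of `𝐍`, defined on `(Ω, P)`, is a Poisson point process with (finite)
intensity measure `ν`: counts of measurable sets are Poisson distributed, and counts of pairwise
disjoint measurable sets are independent. -/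
structure IsPoissonProcess {X : Type*} [MeasurableSpace X] {Ω : Type*} [MeasurableSpace Ω]
    (ν : Measure X) (P : Measure Ω) (η : Ω → Config X) : Prop where
  measurable : Measurable η
  count_law : ∀ A : Set X, MeasurableSet A →
    P.map (fun ω => (η ω).1 A)
      = (poissonMeasure (ν A).toNNReal).map (Nat.cast : ℕ → ℝ≥0∞)
  indep : ∀ (n : ℕ) (A : Fin n → Set X), (∀ i, MeasurableSet (A i)) →
    Pairwise (fun i j => Disjoint (A i) (A j)) →
    iIndepFun (fun (i : Fin n) (ω : Ω) => (η ω).1 (A i)) P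

/-- The difference operator `D_y F(x) = F(x + δ_y) - F(x)`. -/
noncomputable def diff {X : Type*} [MeasurableSpace X] (y : X) (F : Config X → ℝ) :
    Config X → ℝ :=
  fun x => F (x.addPoint y) - F x

/-- The iterated difference operator, `D^0 F = F` and
`D^n_{y₁, …, y_n} F = D_{y₁} D^{n-1}_{y₂, …, y_n} F`. -/
noncomputable def iterDiff {X : Type*} [MeasurableSpace X] :
    (n : ℕ) → (Fin n → X) → (Config X → ℝ) → Config X → ℝ
  | 0, _, F => F
  | n + 1, y, F => diff (y 0) (iterDiff n (Fin.tail y) F)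

/-- `T_n F(y₁, …, y_n) = 𝔼 D^n_{y₁, …, y_n} F(η)`. -/
noncomputable def meanDiff {X : Type*} [MeasurableSpace X] {Ω : Type*} [MeasurableSpace Ω]
    (P : Measure Ω) (η : Ω → Config X) (n : ℕ) (F : Config X → ℝ) (y : Fin n → X) : ℝ :=
  ∫ ω, iterDiff n y F (η ω) ∂P

end PoissonFunctionals

/-! The density turns `𝔼 ∏ F_j(μ)` into `𝔼 G(η) p(η)` with `G = ∏ F_j`, and the theorem becomes a
case of the Fock space formula `𝔼 G(η) H(η) = ∑ₙ (1/n!) ⟨Tₙ G, Tₙ H⟩ₙ` for `G, H ∈ L₂(P_η)`. Its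
term `n = 0` is `𝔼 G(η) · 𝔼 p(η) = 𝔼 G(η)`. The terms with `n > q` vanish: `G(x)` is a sum, over
subsets of `x` with at most `q` points, of terms depending only on the subset, and `D^n` at `n`
distinct points outside `x` keeps only the subsets that contain all of them. Since the intensity has
no atoms, almost all `y` have distinct coordinates and are almost surely disjoint from `η`.

The Fock space formula is checked on the exponential functionals `x ↦ exp (-∫ g dx)`, where `Tₙ` is
explicit and the right-hand side is an exponential series (`hasSum_expFunctional`). These
functionals span a dense subspace of `L₂(P_η)` (`dense_span_expFunctional`), because Laplace
functionals determine finite measures on the space of configurations. Hence the correspondence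
extends to an isometry of `L₂(P_η)` into a Fock space.

It remains to see that the components of this isometry are the `Tₙ`, up to normalization, on all of
`L₂(P_η)`. For this it suffices that `Tₙ` is continuous into the larger space `L₁`
(`exists_clm_meanDiff`), which follows from Mecke's formula, finiteness of all moments of the number
of points, and the Cauchy–Schwarz inequality. Mecke's formula in turn comes from the Stein–Chen
identity for Poisson counts, again tested on exponential functionals. -/

/-! ### Moments determine measures on a cube -/

open BoundedContinuousFunction in
/-- Finite measures on a finite-dimensional cube are determined by their moments. -/
theorem MeasureTheory.Measure.ext_of_integral_prod_pow {ι : Type*} [Fintype ι]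
    {M M' : Measure (ι → unitInterval)} [IsFiniteMeasure M] [IsFiniteMeasure M']
    (h : ∀ k : ι → ℕ, ∫ z, ∏ i, (z i : ℝ) ^ k i ∂M = ∫ z, ∏ i, (z i : ℝ) ^ k i ∂M') :
    M = M' := by
  classical
  let coord : ι → ((ι → unitInterval) →ᵇ ℝ) := fun i =>
    BoundedContinuousFunction.mkOfCompact ⟨fun z => (z i : ℝ), by fun_prop⟩
  let A : StarSubalgebra ℝ ((ι → unitInterval) →ᵇ ℝ) :=
    { Algebra.adjoin ℝ (Set.range coord) with
      star_mem' := fun {a} ha => by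
        have : star a = a := by ext z; simp
        rwa [this] }
  have hmon : ∀ f ∈ Submonoid.closure (Set.range coord),
      ∃ k : ι → ℕ, ∀ z, f z = ∏ i, (z i : ℝ) ^ k i := by
    intro f hf
    induction hf using Submonoid.closure_induction with
    | mem f hf =>
      obtain ⟨i, rfl⟩ := hf
      refine ⟨Pi.single i 1, fun z => ?_⟩
      rw [Finset.prod_eq_single i]
      · simp [coord]
      · intro j _ hj
        simp [hj]
      · simp
    | one => exact ⟨0, fun z => by simp⟩
    | mul f g _ _ hf hg =>
      obtain ⟨k, hk⟩ := hf
      obtain ⟨l, hl⟩ := hg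
      exact ⟨k + l, fun z => by simp [hk, hl, pow_add, Finset.prod_mul_distrib]⟩
  -- Stone–Weierstrass: the algebra generated by the coordinates separates points, and it is spanned
  -- by the monomials, whose integrals agree.
  refine ext_of_forall_mem_subalgebra_integral_eq_of_polish (A := A) ?_ ?_
  · intro x y hxy
    obtain ⟨i, hi⟩ := Function.ne_iff.1 hxy
    refine ⟨coord i, ?_, ?_⟩
    · refine ⟨toContinuousMapStarₐ ℝ (coord i), ?_, rfl⟩
      exact ⟨coord i, Algebra.subset_adjoin ⟨i, rfl⟩, rfl⟩
    · simpa [coord, Subtype.ext_iff] using hi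
  · intro g hg
    have hg' : g ∈ Submodule.span ℝ (Submonoid.closure (Set.range coord) : Set _) := by
      rw [← Algebra.adjoin_eq_span]
      exact hg
    induction hg' using Submodule.span_induction with
    | mem f hf =>
      obtain ⟨k, hk⟩ := hmon f hf
      simpa [hk] using h k
    | zero => simp
    | add f g hf' hg' ihf ihg =>
      have e : ∀ f ∈ Submodule.span ℝ (Submonoid.closure (Set.range coord) : Set _), f ∈ A := by
        intro f hf
        rw [← Algebra.adjoin_eq_span] at hf
        exact hf
      simp only [BoundedContinuousFunction.add_apply]
      rw [integral_add (f.integrable _) (g.integrable _),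
        integral_add (f.integrable _) (g.integrable _), ihf (e f hf'), ihg (e g hg')]
    | smul c f hf ih =>
      have e : f ∈ A := by
        rw [← Algebra.adjoin_eq_span] at hf
        exact hf
      simp only [BoundedContinuousFunction.smul_apply, smul_eq_mul, integral_const_mul]
      rw [ih e]

/-! ### Laplace functionals on the space of configurations -/

namespace PoissonFunctionals

variable {X : Type*} [MeasurableSpace X]

theorem Config.measurable_coe : Measurable (fun x : Config X => x.1) := measurable_subtype_coe

theorem Config.measurable_apply {A : Set X} (hA : MeasurableSet A) :
    Measurable (fun x : Config X => x.1 A) :=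
  (Measure.measurable_coe hA).comp Config.measurable_coe

theorem Config.apply_ne_top (x : Config X) (A : Set X) : x.1 A ≠ ∞ := by
  obtain ⟨n, hn⟩ := x.2 Set.univ MeasurableSet.univ
  exact ((measure_mono (Set.subset_univ A)).trans_lt (by simp [hn])).ne

theorem Config.isFiniteMeasure (x : Config X) : IsFiniteMeasure x.1 :=
  ⟨(x.apply_ne_top Set.univ).lt_top⟩

/-- The exponential functional `x ↦ exp (-∫ g dx)`. -/
noncomputable def expFunctional (g : SimpleFunc X ℝ≥0) (x : Config X) : ℝ :=
  Real.exp (-(∫⁻ y, g y ∂x.1).toReal)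

theorem measurable_expFunctional (g : SimpleFunc X ℝ≥0) : Measurable (expFunctional g) := by
  unfold expFunctional
  have : Measurable fun x : Config X => ∫⁻ y, (g y : ℝ≥0∞) ∂x.1 :=
    (Measure.measurable_lintegral g.measurable.coe_nnreal_ennreal).comp Config.measurable_coe
  fun_prop

theorem expFunctional_pos (g : SimpleFunc X ℝ≥0) (x : Config X) : 0 < expFunctional g x :=
  Real.exp_pos _

theorem expFunctional_le_one (g : SimpleFunc X ℝ≥0) (x : Config X) : expFunctional g x ≤ 1 := by
  simp [expFunctional]

theorem norm_expFunctional_le (g : SimpleFunc X ℝ≥0) (x : Config X) : ‖expFunctional g x‖ ≤ 1 := by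
  rw [Real.norm_of_nonneg (expFunctional_pos g x).le]
  exact expFunctional_le_one g x

theorem Config.lintegral_ne_top (x : Config X) (g : SimpleFunc X ℝ≥0) :
    ∫⁻ y, (g y : ℝ≥0∞) ∂x.1 ≠ ∞ := by
  have := x.isFiniteMeasure
  obtain ⟨C, hC⟩ := g.exists_forall_le
  refine ((lintegral_mono (g := fun _ => (C : ℝ≥0∞)) fun y =>
    ENNReal.coe_le_coe.2 (hC y)).trans_lt ?_).ne
  rw [lintegral_const]
  exact ENNReal.mul_lt_top (by simp) (measure_lt_top _ _)

theorem expFunctional_add (g h : SimpleFunc X ℝ≥0) (x : Config X) :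
    expFunctional (g + h) x = expFunctional g x * expFunctional h x := by
  simp only [expFunctional]
  rw [← Real.exp_add, ← neg_add, ← ENNReal.toReal_add (x.lintegral_ne_top g) (x.lintegral_ne_top h),
    ← lintegral_add_left g.measurable.coe_nnreal_ennreal]
  simp

theorem expFunctional_zero (x : Config X) : expFunctional (0 : SimpleFunc X ℝ≥0) x = 1 := by
  simp [expFunctional]

/-- The simple function `1_A`. -/
noncomputable def simpleIndicator {A : Set X} (hA : MeasurableSet A) : SimpleFunc X ℝ≥0 :=
  SimpleFunc.piecewise A hA (SimpleFunc.const X 1) (SimpleFunc.const X 0)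

theorem expFunctional_simpleIndicator {A : Set X} (hA : MeasurableSet A) (x : Config X) :
    expFunctional (simpleIndicator hA) x = Real.exp (-(x.1 A).toReal) := by
  have : ∀ y, ((simpleIndicator hA y : ℝ≥0) : ℝ≥0∞) = A.indicator 1 y := by
    intro y
    by_cases hy : y ∈ A <;> simp [simpleIndicator, hy]
  simp [expFunctional, this, lintegral_indicator_one hA]

/-- Take `g = ∑ k i • 1_{A i}`. The Laplace functional of a law thus contains all mixed moments of
the variables `exp (-x(A i))`, which take values in the unit interval. -/
theorem exists_expFunctional_eq_prod_pow {ι : Type*} (s : Finset ι) {A : ι → Set X}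
    (hA : ∀ i, MeasurableSet (A i)) (k : ι → ℕ) :
    ∃ g : SimpleFunc X ℝ≥0, ∀ x : Config X,
      ∏ i ∈ s, Real.exp (-(x.1 (A i)).toReal) ^ k i = expFunctional g x := by
  classical
  have hpow : ∀ (g : SimpleFunc X ℝ≥0) (n : ℕ) (x : Config X),
      expFunctional (n • g) x = expFunctional g x ^ n := by
    intro g n x
    induction n with
    | zero => simp [expFunctional_zero]
    | succ n ih => rw [succ_nsmul, expFunctional_add, ih, pow_succ]
  induction s using Finset.induction_on with
  | empty => exact ⟨0, fun x => by simp [expFunctional_zero]⟩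
  | insert i s hi ih =>
    obtain ⟨g, hg⟩ := ih
    refine ⟨k i • simpleIndicator (hA i) + g, fun x => ?_⟩
    rw [Finset.prod_insert hi, hg, expFunctional_add, hpow, expFunctional_simpleIndicator]

/-- Finite measures on the space of configurations are determined by their Laplace functionals. -/
theorem measure_ext_of_integral_expFunctional {M M' : Measure (Config X)} [IsFiniteMeasure M]
    [IsFiniteMeasure M']
    (h : ∀ g : SimpleFunc X ℝ≥0, ∫ x, expFunctional g x ∂M = ∫ x, expFunctional g x ∂M') :
    M = M' := by
  let 𝒜 := {A : Set X // MeasurableSet A}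
  let φ : Config X → 𝒜 → unitInterval := fun x A =>
    ⟨Real.exp (-(x.1 A.1).toReal), (Real.exp_pos _).le, by simp⟩
  have hφ : Measurable φ := by
    refine measurable_pi_lambda _ fun A => Measurable.subtype_mk ?_
    have := Config.measurable_apply (X := X) A.2
    fun_prop
  -- The finite-dimensional marginals agree by the moment criterion on cubes, and a projective limit
  -- of finite measures is unique.
  have key : M.map φ = M'.map φ := by
    have hlim : ∀ N : Measure (Config X),
        IsProjectiveLimit (N.map φ) fun J => (N.map φ).map J.restrict := fun _ _ => rfl
    have heq : (fun J : Finset 𝒜 => (M.map φ).map J.restrict)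
        = fun J => (M'.map φ).map J.restrict := by
      funext J
      refine Measure.ext_of_integral_prod_pow fun k => ?_
      obtain ⟨g, hg⟩ := exists_expFunctional_eq_prod_pow (Finset.univ : Finset J)
        (A := fun i => i.1.1) (fun i => i.1.2) k
      have : ∀ N : Measure (Config X),
          ∫ z, ∏ i, (z i : ℝ) ^ k i ∂((N.map φ).map J.restrict) = ∫ x, expFunctional g x ∂N := by
        intro N
        rw [Measure.map_map (by fun_prop) hφ, integral_map (by fun_prop)]
        · simp only [← hg]
          rfl
        · exact Continuous.aestronglyMeasurable (by fun_prop)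
      rw [this, this, h]
    have : ∀ J : Finset 𝒜, IsFiniteMeasure ((M'.map φ).map J.restrict) := fun J => inferInstance
    exact IsProjectiveLimit.unique (heq ▸ hlim M) (hlim M')
  -- No information is lost under `φ`: the count `x A` is finite, so it is recovered as minus the
  -- logarithm of the coordinate `A`.
  have hle : (Config.instMeasurableSpace X) ≤ MeasurableSpace.comap φ inferInstance := by
    have h0 : @Measurable _ _ (MeasurableSpace.comap φ inferInstance) _
        (fun x : Config X => x.1) := by
      refine @Measure.measurable_of_measurable_coe _ _ _ (MeasurableSpace.comap φ inferInstance) _ ?_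
      intro s hs
      have h1 : (fun x : Config X => x.1 s)
          = (fun z : 𝒜 → unitInterval => ENNReal.ofReal (-Real.log (z ⟨s, hs⟩))) ∘ φ := by
        funext x
        simp [φ, Real.log_exp, ENNReal.ofReal_toReal (x.apply_ne_top s)]
      rw [h1]
      refine Measurable.comp ?_ (comap_measurable φ)
      fun_prop
    rintro s ⟨t, ht, rfl⟩
    exact h0 ht
  ext s hs
  obtain ⟨t, ht, rfl⟩ := hle s hs
  rw [← Measure.map_apply hφ ht, ← Measure.map_apply hφ ht, key]

end PoissonFunctionals

/-! ### Identities for the Poisson distribution -/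

theorem ProbabilityTheory.lintegral_poissonMeasure (r : ℝ≥0) (f : ℕ → ℝ≥0∞) :
    ∫⁻ n, f n ∂poissonMeasure r
      = ∑' n, f n * ENNReal.ofReal (Real.exp (-r) * (r : ℝ) ^ n / n.factorial) := by
  rw [lintegral_countable']
  simp only [poissonMeasure_singleton]

/-- The Stein–Chen identity of the Poisson distribution. -/
theorem ProbabilityTheory.lintegral_id_mul_poissonMeasure (r : ℝ≥0) (f : ℕ → ℝ≥0∞) :
    ∫⁻ n, (n : ℝ≥0∞) * f n ∂poissonMeasure r = r * ∫⁻ n, f (n + 1) ∂poissonMeasure r := by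
  rw [lintegral_poissonMeasure, lintegral_poissonMeasure, tsum_eq_zero_add' ENNReal.summable,
    ← ENNReal.tsum_mul_left]
  simp only [Nat.cast_zero, zero_mul, zero_add]
  refine tsum_congr fun n => ?_
  have h : ((n + 1 : ℕ) : ℝ≥0∞)
        * ENNReal.ofReal (Real.exp (-r) * (r : ℝ) ^ (n + 1) / (n + 1).factorial)
      = r * ENNReal.ofReal (Real.exp (-r) * (r : ℝ) ^ n / n.factorial) := by
    rw [← ENNReal.ofReal_natCast, ← ENNReal.ofReal_coe_nnreal, ← ENNReal.ofReal_mul (by positivity),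
      ← ENNReal.ofReal_mul (by positivity)]
    congr 1
    rw [Nat.factorial_succ]
    have : ((n : ℝ) + 1) ≠ 0 := by positivity
    have : (n.factorial : ℝ) ≠ 0 := by positivity
    push_cast
    field_simp
    ring
  rw [mul_right_comm, h]
  ring

theorem ProbabilityTheory.lintegral_exp_poissonMeasure (r : ℝ≥0) (c : ℝ) :
    ∫⁻ n : ℕ, ENNReal.ofReal (Real.exp (-(c * n))) ∂poissonMeasure r
      = ENNReal.ofReal (Real.exp (-(1 - Real.exp (-c)) * r)) := by
  rw [lintegral_poissonMeasure]
  have h := ((NormedSpace.expSeries_div_hasSum_exp (r * Real.exp (-c))).mul_left (Real.exp (-r)))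
  rw [← Real.exp_eq_exp_ℝ] at h
  have h2 : ∀ n : ℕ, ENNReal.ofReal (Real.exp (-(c * n)))
      * ENNReal.ofReal (Real.exp (-r) * (r : ℝ) ^ n / n.factorial)
      = ENNReal.ofReal (Real.exp (-r) * ((r * Real.exp (-c)) ^ n / n.factorial)) := by
    intro n
    rw [← ENNReal.ofReal_mul (by positivity), mul_pow, ← Real.exp_nat_mul]
    congr 1
    rw [show -(c * n) = (n : ℝ) * -c by ring]
    ring
  simp_rw [h2]
  rw [← ENNReal.ofReal_tsum_of_nonneg (fun n => by positivity) h.summable, h.tsum_eq,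
    ← Real.exp_add]
  congr 2
  ring

/-! ### The Laplace functional of a Poisson process and Mecke's formula -/

namespace PoissonFunctionals

variable {X : Type*} [MeasurableSpace X] {ν : Measure X}

/-- Passes to the canonical process: from here on the sample space is the space of configurations
itself, with `Q` the law of `η`. -/
theorem IsPoissonProcess.law {Ω : Type*} [MeasurableSpace Ω] {P : Measure Ω}
    [IsProbabilityMeasure P] {η : Ω → Config X} (hη : IsPoissonProcess ν P η) :
    IsPoissonProcess ν (P.map η) id where
  measurable := measurable_id
  count_law A hA := by
    rw [← hη.count_law A hA]
    exact Measure.map_map (Config.measurable_apply hA) hη.measurable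
  indep n A hA hd := by
    have : IsProbabilityMeasure (P.map η) :=
      Measure.isProbabilityMeasure_map hη.measurable.aemeasurable
    have h := hη.indep n A hA hd
    have hm : ∀ i, Measurable (fun x : Config X => x.1 (A i)) :=
      fun i => Config.measurable_apply (hA i)
    have hm' : ∀ i, Measurable (fun ω => (η ω).1 (A i)) := fun i => (hm i).comp hη.measurable
    have hmap : ∀ i, (P.map η).map (fun x : Config X => x.1 (A i))
        = P.map (fun ω => (η ω).1 (A i)) := fun i => Measure.map_map (hm i) hη.measurable
    have hmap' : (P.map η).map (fun (x : Config X) i => x.1 (A i))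
        = P.map (fun ω i => (η ω).1 (A i)) :=
      Measure.map_map (measurable_pi_lambda _ hm) hη.measurable
    refine (iIndepFun_iff_map_fun_eq_pi_map (fun i => (hm i).aemeasurable)).2 ?_
    rw [hmap', (iIndepFun_iff_map_fun_eq_pi_map (fun i => (hm' i).aemeasurable)).1 h]
    simp_rw [hmap]

variable {Q : Measure (Config X)}

theorem IsPoissonProcess.lintegral_prod_counts {ι : Type*} [Fintype ι]
    (hQ : IsPoissonProcess ν Q id) {A : ι → Set X} (hA : ∀ i, MeasurableSet (A i))
    (hd : Pairwise fun i j => Disjoint (A i) (A j)) {f : ι → ℝ≥0∞ → ℝ≥0∞}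
    (hf : ∀ i, Measurable (f i)) :
    ∫⁻ x, ∏ i, f i (x.1 (A i)) ∂Q
      = ∏ i, ∫⁻ n : ℕ, f i n ∂poissonMeasure (ν (A i)).toNNReal := by
  let e := Fintype.equivFin ι
  have h1 := hQ.indep _ (fun j => A (e.symm j)) (fun j => hA _)
    (fun i j hij => hd (e.symm.injective.ne hij))
  have h2 := h1.precomp (g := e) e.injective
  simp only [Equiv.symm_apply_apply, id] at h2
  have h3 := h2.comp f hf
  rw [lintegral_prod_eq_prod_lintegral_of_indepFun Finset.univ
    (fun i (x : Config X) => f i (x.1 (A i))) h3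
    (fun i => (hf i).comp (Config.measurable_apply (hA i)))]
  refine Finset.prod_congr rfl fun i _ => ?_
  have h4 : ∫⁻ ω, f i (ω.1 (A i)) ∂Q = ∫⁻ z, f i z ∂Q.map (fun x => x.1 (A i)) :=
    (lintegral_map (hf i) (Config.measurable_apply (hA i))).symm
  rw [h4, show Q.map (fun x => x.1 (A i)) = _ from hQ.count_law _ (hA i),
    lintegral_map (hf i) (by fun_prop)]

theorem lintegral_simpleFunc_comp (M : Measure X) (g : SimpleFunc X ℝ≥0) (h : ℝ≥0 → ℝ≥0∞) :
    ∫⁻ y, h (g y) ∂M = ∑ c : g.range, h c * M (g ⁻¹' {c.1}) := by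
  rw [Finset.sum_coe_sort g.range (fun c => h c * M (g ⁻¹' {c})), ← SimpleFunc.map_lintegral,
    ← SimpleFunc.lintegral_eq_lintegral]
  rfl

theorem expFunctional_eq_prod (g : SimpleFunc X ℝ≥0) (x : Config X) :
    expFunctional g x = ∏ c : g.range, Real.exp (-((c : ℝ≥0) * (x.1 (g ⁻¹' {c.1})).toReal)) := by
  rw [expFunctional, lintegral_simpleFunc_comp x.1 g (fun c => c), ← Real.exp_sum,
    ENNReal.toReal_sum fun c _ => ENNReal.mul_ne_top (by simp) (x.apply_ne_top _)]
  simp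

theorem ofReal_expFunctional_eq_prod (g : SimpleFunc X ℝ≥0) (x : Config X) :
    ENNReal.ofReal (expFunctional g x)
      = ∏ c : g.range, ENNReal.ofReal (Real.exp (-((c : ℝ≥0) * (x.1 (g ⁻¹' {c.1})).toReal))) := by
  rw [expFunctional_eq_prod, ENNReal.ofReal_prod_of_nonneg fun c _ => (Real.exp_pos _).le]

theorem pairwise_disjoint_fibers (g : SimpleFunc X ℝ≥0) :
    Pairwise fun c c' : g.range => Disjoint (g ⁻¹' {c.1}) (g ⁻¹' {c'.1}) := by
  intro c c' h
  exact Disjoint.preimage _ (Set.disjoint_singleton.2 (Subtype.coe_injective.ne h))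

theorem IsPoissonProcess.lintegral_expFunctional (hQ : IsPoissonProcess ν Q id)
    (g : SimpleFunc X ℝ≥0) :
    ∫⁻ x, ENNReal.ofReal (expFunctional g x) ∂Q
      = ∏ c : g.range, ENNReal.ofReal
          (Real.exp (-(1 - Real.exp (-(c : ℝ≥0))) * (ν (g ⁻¹' {c.1})).toNNReal)) := by
  simp_rw [ofReal_expFunctional_eq_prod]
  rw [hQ.lintegral_prod_counts (ι := g.range)
    (f := fun c z => ENNReal.ofReal (Real.exp (-((c : ℝ≥0) * z.toReal))))
    (fun c => g.measurableSet_fiber c) (pairwise_disjoint_fibers g) (fun c => by fun_prop)]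
  simp [lintegral_exp_poissonMeasure]

theorem IsPoissonProcess.integral_expFunctional [IsFiniteMeasure ν] (hQ : IsPoissonProcess ν Q id)
    (g : SimpleFunc X ℝ≥0) :
    ∫ x, expFunctional g x ∂Q = Real.exp (-∫ y, (1 - Real.exp (-(g y : ℝ))) ∂ν) := by
  rw [integral_eq_lintegral_of_nonneg_ae (.of_forall fun x => (expFunctional_pos g x).le)
    (measurable_expFunctional g).aestronglyMeasurable, hQ.lintegral_expFunctional,
    ← ENNReal.ofReal_prod_of_nonneg (fun c _ => (Real.exp_pos _).le),
    ENNReal.toReal_ofReal (Finset.prod_nonneg fun c _ => (Real.exp_pos _).le), ← Real.exp_sum]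
  congr 1
  have hg : Measurable fun y => (g y : ℝ) := g.measurable.coe_nnreal_real
  rw [integral_eq_lintegral_of_nonneg_ae (.of_forall fun y => by simp) (by fun_prop),
    lintegral_simpleFunc_comp ν g (fun c => ENNReal.ofReal (1 - Real.exp (-(c : ℝ)))),
    ENNReal.toReal_sum fun c _ => ENNReal.mul_ne_top (by simp) (measure_ne_top _ _),
    ← Finset.sum_neg_distrib]
  refine Finset.sum_congr rfl fun c _ => ?_
  rw [ENNReal.toReal_mul, ENNReal.toReal_ofReal (by simp), neg_mul]
  rfl

/-- The number of points of a configuration. -/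
def Config.total (x : Config X) : ℝ≥0∞ := x.1 Set.univ

theorem Config.measurable_total : Measurable (Config.total (X := X)) :=
  Config.measurable_apply MeasurableSet.univ

/-- This is Mecke's formula for exponential functionals. The total count is the sum of the counts of
the fibers of `g`; in each summand independence separates the fibers, and the Stein–Chen identity is
applied to the distinguished one. -/
theorem IsPoissonProcess.lintegral_total_mul_expFunctional [IsFiniteMeasure ν]
    (hQ : IsPoissonProcess ν Q id) (g : SimpleFunc X ℝ≥0) :
    ∫⁻ x, x.total * ENNReal.ofReal (expFunctional g x) ∂Q
      = (∫⁻ y, ENNReal.ofReal (Real.exp (-(g y : ℝ))) ∂ν)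
        * ∫⁻ x, ENNReal.ofReal (expFunctional g x) ∂Q := by
  classical
  have ht : ∀ x : Config X, x.total = ∑ c : g.range, x.1 (g ⁻¹' {c.1}) := by
    intro x
    simpa [Config.total] using lintegral_simpleFunc_comp x.1 g (fun _ => 1)
  let f : g.range → g.range → ℝ≥0∞ → ℝ≥0∞ := fun c c' z =>
    (if c' = c then z else 1) * ENNReal.ofReal (Real.exp (-((c' : ℝ≥0) * z.toReal)))
  have hf : ∀ c c', Measurable (f c c') := by
    intro c c'
    by_cases h : c' = c <;> simp only [f, h, if_true, if_false] <;> fun_prop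
  have hprod : ∀ (c : g.range) (x : Config X),
      x.1 (g ⁻¹' {c.1}) * ENNReal.ofReal (expFunctional g x)
        = ∏ c', f c c' (x.1 (g ⁻¹' {c'.1})) := by
    intro c x
    simp only [f]
    rw [Finset.prod_mul_distrib, ofReal_expFunctional_eq_prod, Finset.prod_ite_eq' Finset.univ c]
    simp
  simp_rw [ht, Finset.sum_mul, hprod]
  have hm : ∀ c, Measurable fun x : Config X => ∏ c', f c c' (x.1 (g ⁻¹' {c'.1})) :=
    fun c => Finset.measurable_fun_prod _ fun c' _ =>
      (hf c c').comp (Config.measurable_apply (g.measurableSet_fiber c'.1))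
  rw [lintegral_finsetSum _ fun c _ => hm c,
    lintegral_simpleFunc_comp ν g (fun c => ENNReal.ofReal (Real.exp (-(c : ℝ)))),
    Finset.sum_mul]
  refine Finset.sum_congr rfl fun c _ => ?_
  rw [hQ.lintegral_prod_counts (ι := g.range) (fun c => g.measurableSet_fiber c) (pairwise_disjoint_fibers g)
    (hf c), hQ.lintegral_expFunctional]
  -- In the distinguished fiber the Stein–Chen identity replaces the factor `n` by the mean and
  -- shifts `n` to `n + 1`; the shift contributes the factor `exp (-c)`.
  have h1 : ∀ c', ∫⁻ n : ℕ, f c c' n ∂poissonMeasure (ν (g ⁻¹' {c'.1})).toNNReal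
      = (if c' = c then ENNReal.ofReal (Real.exp (-(c'.1 : ℝ))) * ν (g ⁻¹' {c'.1}) else 1)
        * ENNReal.ofReal
          (Real.exp (-(1 - Real.exp (-(c' : ℝ≥0))) * (ν (g ⁻¹' {c'.1})).toNNReal)) := by
    intro c'
    by_cases h : c' = c
    · simp only [f, h, if_true, ENNReal.toReal_natCast]
      rw [lintegral_id_mul_poissonMeasure _
        (fun n => ENNReal.ofReal (Real.exp (-((c.1 : ℝ) * n)))), ENNReal.coe_toNNReal
        (measure_ne_top _ _), ← lintegral_exp_poissonMeasure, ← lintegral_const_mul' _ _ (by simp),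
        ← lintegral_const_mul' _ _ (by finiteness)]
      refine lintegral_congr fun n => ?_
      rw [mul_right_comm, ← ENNReal.ofReal_mul (Real.exp_pos _).le, ← Real.exp_add, mul_comm]
      congr 3
      push_cast
      ring
    · simp [f, h, lintegral_exp_poissonMeasure]
  simp_rw [h1]
  rw [Finset.prod_mul_distrib, Finset.prod_ite_eq' Finset.univ c]
  simp

theorem Config.measurable_addPoint :
    Measurable (fun z : Config X × X => z.1.addPoint z.2) := by
  refine Measurable.subtype_mk ?_
  refine Measure.measurable_of_measurable_coe _ fun A hA => ?_
  simp only [Measure.add_apply, Measure.dirac_apply' _ hA]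
  exact ((Config.measurable_apply hA).comp measurable_fst).add
    ((measurable_one.indicator hA).comp measurable_snd)

theorem Config.total_addPoint (x : Config X) (y : X) : (x.addPoint y).total = x.total + 1 := by
  simp [Config.total, Config.addPoint]

theorem expFunctional_addPoint (g : SimpleFunc X ℝ≥0) (x : Config X) (y : X) :
    expFunctional g (x.addPoint y) = Real.exp (-(g y : ℝ)) * expFunctional g x := by
  simp only [expFunctional, Config.addPoint]
  rw [lintegral_add_measure, lintegral_dirac' _ g.measurable.coe_nnreal_ennreal,
    ENNReal.toReal_add (x.lintegral_ne_top g) (by simp), neg_add, Real.exp_add, mul_comm]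
  rfl

/-- Mecke's formula, for the measures. -/
theorem IsPoissonProcess.map_addPoint [IsFiniteMeasure ν] [IsProbabilityMeasure Q]
    (hQ : IsPoissonProcess ν Q id) :
    (Q.prod ν).map (fun z => z.1.addPoint z.2) = Q.withDensity Config.total := by
  -- The case `g = 0` of the preceding identity says that the mean number of points is the total
  -- mass of `ν`.
  have hfin : IsFiniteMeasure (Q.withDensity Config.total) := by
    refine isFiniteMeasure_withDensity ?_
    have := hQ.lintegral_total_mul_expFunctional 0
    simp only [expFunctional_zero] at this
    simp only [ENNReal.ofReal_one, mul_one, lintegral_const, measure_univ, SimpleFunc.coe_zero,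
      Pi.zero_apply, NNReal.coe_zero, neg_zero, Real.exp_zero, one_mul] at this
    rw [this]
    exact measure_ne_top _ _
  refine measure_ext_of_integral_expFunctional fun g => ?_
  have hg := measurable_expFunctional g
  have hg' : Measurable fun y => (g y : ℝ) := g.measurable.coe_nnreal_real
  rw [integral_eq_lintegral_of_nonneg_ae (.of_forall fun x => (expFunctional_pos g x).le)
    hg.aestronglyMeasurable,
    integral_eq_lintegral_of_nonneg_ae (.of_forall fun x => (expFunctional_pos g x).le)
    hg.aestronglyMeasurable, lintegral_map hg.ennreal_ofReal Config.measurable_addPoint,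
    lintegral_withDensity_eq_lintegral_mul _ Config.measurable_total hg.ennreal_ofReal]
  simp only [Pi.mul_apply]
  rw [hQ.lintegral_total_mul_expFunctional, mul_comm]
  simp_rw [expFunctional_addPoint, mul_comm (Real.exp _)]
  simp_rw [ENNReal.ofReal_mul (expFunctional_pos g _).le]
  rw [lintegral_prod_mul (f := fun x => ENNReal.ofReal (expFunctional g x))
    (g := fun y => ENNReal.ofReal (Real.exp (-(g y : ℝ)))) hg.ennreal_ofReal.aemeasurable
    (by fun_prop)]

/-- Mecke's formula. -/
theorem IsPoissonProcess.lintegral_addPoint [IsFiniteMeasure ν] [IsProbabilityMeasure Q]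
    (hQ : IsPoissonProcess ν Q id) {f : Config X → ℝ≥0∞} (hf : Measurable f) :
    ∫⁻ x, ∫⁻ y, f (x.addPoint y) ∂ν ∂Q = ∫⁻ x, x.total * f x ∂Q := by
  have h := congrArg (fun M => ∫⁻ x, f x ∂M) hQ.map_addPoint
  rw [lintegral_map hf Config.measurable_addPoint,
    lintegral_withDensity_eq_lintegral_mul _ Config.measurable_total hf] at h
  rw [← lintegral_prod (fun z : Config X × X => f (z.1.addPoint z.2))
    (hf.comp Config.measurable_addPoint).aemeasurable]
  exact h

end PoissonFunctionals

/-! ### Difference operators as bounded maps from `L₂` to `L₁` -/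

namespace PoissonFunctionals

variable {X : Type*} [MeasurableSpace X] {ν : Measure X} {Q : Measure (Config X)}

theorem iterDiff_succ {n : ℕ} (y : Fin (n + 1) → X) (F : Config X → ℝ) (x : Config X) :
    iterDiff (n + 1) y F x
      = iterDiff n (Fin.tail y) F (x.addPoint (y 0)) - iterDiff n (Fin.tail y) F x := rfl

theorem iterDiff_add (n : ℕ) (y : Fin n → X) (F G : Config X → ℝ) (x : Config X) :
    iterDiff n y (fun x => F x + G x) x = iterDiff n y F x + iterDiff n y G x := by
  induction n generalizing x with
  | zero => rfl
  | succ n ih => simp only [iterDiff_succ, ih]; ring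

theorem iterDiff_const_mul (n : ℕ) (y : Fin n → X) (c : ℝ) (F : Config X → ℝ) (x : Config X) :
    iterDiff n y (fun x => c * F x) x = c * iterDiff n y F x := by
  induction n generalizing x with
  | zero => rfl
  | succ n ih => simp only [iterDiff_succ, ih]; ring

/-- Adds the first of `n + 1` points to the configuration. -/
noncomputable def addFirst (n : ℕ) (z : Config X × (Fin (n + 1) → X)) :
    Config X × (Fin n → X) := (z.1.addPoint (z.2 0), Fin.tail z.2)

/-- Drops the first of `n + 1` points. -/
def dropFirst (n : ℕ) (z : Config X × (Fin (n + 1) → X)) :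
    Config X × (Fin n → X) := (z.1, Fin.tail z.2)

theorem measurable_tail (n : ℕ) : Measurable (Fin.tail : (Fin (n + 1) → X) → Fin n → X) :=
  measurable_pi_lambda _ fun _ => measurable_pi_apply _

theorem measurable_addFirst (n : ℕ) : Measurable (addFirst (X := X) n) :=
  (Config.measurable_addPoint.comp
    (measurable_fst.prodMk ((measurable_pi_apply 0).comp measurable_snd))).prodMk
    ((measurable_tail n).comp measurable_snd)

theorem measurable_dropFirst (n : ℕ) : Measurable (dropFirst (X := X) n) :=
  measurable_fst.prodMk ((measurable_tail n).comp measurable_snd)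

theorem measurable_iterDiff (n : ℕ) {F : Config X → ℝ} (hF : Measurable F) :
    Measurable fun z : Config X × (Fin n → X) => iterDiff n z.2 F z.1 := by
  induction n with
  | zero => exact hF.comp measurable_fst
  | succ n ih =>
    exact (ih.comp (measurable_addFirst n)).sub (ih.comp (measurable_dropFirst n))

/-- Splitting off the first of `n + 1` points preserves the measure. -/
theorem measurePreserving_headTail (ν : Measure X) [SigmaFinite ν] (n : ℕ) :
    MeasurePreserving (fun y : Fin (n + 1) → X => (y 0, Fin.tail y))
      (Measure.pi fun _ => ν) (ν.prod (Measure.pi fun _ => ν)) :=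
  measurePreserving_piFinSuccAbove (fun _ : Fin (n + 1) => ν) 0

theorem measurePreserving_split [SFinite Q] [SigmaFinite ν] (n : ℕ) :
    MeasurePreserving (fun z : Config X × (Fin (n + 1) → X) => ((z.1, z.2 0), Fin.tail z.2))
      (Q.prod (Measure.pi fun _ => ν)) ((Q.prod ν).prod (Measure.pi fun _ => ν)) :=
  (MeasurePreserving.symm MeasurableEquiv.prodAssoc
    (measurePreserving_prodAssoc Q ν (Measure.pi fun _ : Fin n => ν))).comp
    ((MeasurePreserving.id Q).prod (measurePreserving_headTail ν n))

theorem map_dropFirst [SFinite Q] [IsFiniteMeasure ν] (n : ℕ) :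
    (Q.prod (Measure.pi fun _ => ν)).map (dropFirst n)
      = (ν Set.univ • Q).prod (Measure.pi fun _ => ν) := by
  have h : dropFirst (X := X) n = Prod.map Prod.fst id ∘
      fun z : Config X × (Fin (n + 1) → X) => ((z.1, z.2 0), Fin.tail z.2) := rfl
  rw [h, ← Measure.map_map (measurable_fst.prodMap measurable_id)
    (measurePreserving_split (Q := Q) (ν := ν) n).measurable,
    (measurePreserving_split n).map_eq, ← Measure.map_prod_map _ _ measurable_fst measurable_id,
    Measure.map_id, Measure.map_fst_prod]

theorem IsPoissonProcess.map_addFirst [IsProbabilityMeasure Q] [IsFiniteMeasure ν]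
    (hQ : IsPoissonProcess ν Q id) (n : ℕ) :
    (Q.prod (Measure.pi fun _ => ν)).map (addFirst n)
      = (Q.withDensity Config.total).prod (Measure.pi fun _ => ν) := by
  have h : addFirst (X := X) n = Prod.map (fun z => z.1.addPoint z.2) id ∘
      fun z : Config X × (Fin (n + 1) → X) => ((z.1, z.2 0), Fin.tail z.2) := rfl
  rw [h, ← Measure.map_map (Config.measurable_addPoint.prodMap measurable_id)
    (measurePreserving_split (Q := Q) (ν := ν) n).measurable,
    (measurePreserving_split n).map_eq,
    ← Measure.map_prod_map _ _ Config.measurable_addPoint measurable_id,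
    Measure.map_id, hQ.map_addPoint]

theorem quasiMeasurePreserving_dropFirst [SFinite Q] [IsFiniteMeasure ν] (n : ℕ) :
    Measure.QuasiMeasurePreserving (dropFirst n) (Q.prod (Measure.pi fun _ : Fin (n + 1) => ν))
      (Q.prod (Measure.pi fun _ : Fin n => ν)) :=
  ⟨measurable_dropFirst n, map_dropFirst (Q := Q) (ν := ν) n ▸
    (Measure.AbsolutelyContinuous.rfl.smul_left _).prod .rfl⟩

theorem IsPoissonProcess.quasiMeasurePreserving_addFirst [IsProbabilityMeasure Q]
    [IsFiniteMeasure ν] (hQ : IsPoissonProcess ν Q id) (n : ℕ) :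
    Measure.QuasiMeasurePreserving (addFirst n) (Q.prod (Measure.pi fun _ : Fin (n + 1) => ν))
      (Q.prod (Measure.pi fun _ : Fin n => ν)) :=
  ⟨measurable_addFirst n, hQ.map_addFirst n ▸
    (withDensity_absolutelyContinuous _ _).prod .rfl⟩

section

variable [IsProbabilityMeasure Q] [IsFiniteMeasure ν] (hQ : IsPoissonProcess ν Q id)
include hQ

/-- Makes `D^n` meaningful on classes of functionals. Shifting by a point respects null sets
because, by Mecke's formula, the shifted configuration has a law that is absolutely continuous with
respect to `Q`. -/
theorem IsPoissonProcess.iterDiff_congr_ae (n : ℕ) {F G : Config X → ℝ} (h : F =ᵐ[Q] G) :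
    (fun z : Config X × (Fin n → X) => iterDiff n z.2 F z.1)
      =ᵐ[Q.prod (Measure.pi fun _ => ν)] fun z => iterDiff n z.2 G z.1 := by
  induction n with
  | zero => exact Measure.quasiMeasurePreserving_fst.ae_eq_comp h
  | succ n ih =>
    exact ((hQ.quasiMeasurePreserving_addFirst n).ae_eq_comp ih).sub
      ((quasiMeasurePreserving_dropFirst n).ae_eq_comp ih)

theorem IsPoissonProcess.aestronglyMeasurable_iterDiff (n : ℕ) {F : Config X → ℝ}
    (h : AEStronglyMeasurable F Q) :
    AEStronglyMeasurable (fun z : Config X × (Fin n → X) => iterDiff n z.2 F z.1)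
      (Q.prod (Measure.pi fun _ => ν)) :=
  (measurable_iterDiff n h.stronglyMeasurable_mk.measurable).aestronglyMeasurable.congr
    (hQ.iterDiff_congr_ae n h.ae_eq_mk).symm

end

/-- A weight that controls the number of points of a configuration. -/
noncomputable def weight (ν : Measure X) (x : Config X) : ℝ≥0∞ := x.total + (ν Set.univ + 1)

theorem measurable_weight : Measurable (weight ν) := Config.measurable_total.add_const _

theorem weight_addPoint (x : Config X) (y : X) :
    weight ν (x.addPoint y) = weight ν x + 1 := by
  simp only [weight, Config.total_addPoint]
  ring

theorem lintegral_dropFirst [SFinite Q] [IsFiniteMeasure ν] (n : ℕ)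
    {f : Config X × (Fin n → X) → ℝ≥0∞} (hf : Measurable f) :
    ∫⁻ z, f (dropFirst n z) ∂(Q.prod (Measure.pi fun _ => ν))
      = ν Set.univ * ∫⁻ z, f z ∂(Q.prod (Measure.pi fun _ => ν)) := by
  rw [← lintegral_map hf (measurable_dropFirst n), map_dropFirst, Measure.prod_smul_left,
    lintegral_smul_measure, smul_eq_mul]

section

variable [IsProbabilityMeasure Q] [IsFiniteMeasure ν] (hQ : IsPoissonProcess ν Q id)
include hQ

theorem IsPoissonProcess.lintegral_addFirst (n : ℕ)
    {f : Config X × (Fin n → X) → ℝ≥0∞} (hf : Measurable f) :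
    ∫⁻ z, f (addFirst n z) ∂(Q.prod (Measure.pi fun _ => ν))
      = ∫⁻ z, z.1.total * f z ∂(Q.prod (Measure.pi fun _ => ν)) := by
  rw [← lintegral_map hf (measurable_addFirst n), hQ.map_addFirst,
    prod_withDensity_left Config.measurable_total,
    lintegral_withDensity_eq_lintegral_mul _
      (f := fun z : Config X × (Fin n → X) => z.1.total)
      (Config.measurable_total.comp measurable_fst) hf]
  rfl

/-- Induction on the exponent: Mecke's formula trades one factor `x.total` for an added point, which
changes the remaining power only by a bounded factor. -/
theorem IsPoissonProcess.lintegral_weight_pow_lt_top (a : ℕ) : ∫⁻ x, weight ν x ^ a ∂Q < ∞ := by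
  induction a with
  | zero => simp
  | succ a ih =>
    have h1 : ∀ x : Config X, weight ν x ^ (a + 1)
        = x.total * weight ν x ^ a + (ν Set.univ + 1) * weight ν x ^ a := by
      intro x
      rw [pow_succ, mul_comm, ← add_mul]
      rfl
    have hm : Measurable fun x : Config X => weight ν x ^ a := measurable_weight.pow_const a
    simp_rw [h1]
    rw [lintegral_add_right _ (hm.const_mul _), ← hQ.lintegral_addPoint hm,
      lintegral_const_mul _ hm]
    refine ENNReal.add_lt_top.2 ⟨?_, ENNReal.mul_lt_top (by finiteness) ih⟩
    calc ∫⁻ x, ∫⁻ y, weight ν (x.addPoint y) ^ a ∂ν ∂Q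
        ≤ ∫⁻ x, ∫⁻ _y, 2 ^ a * weight ν x ^ a ∂ν ∂Q := by
          refine lintegral_mono fun x => lintegral_mono fun y => ?_
          simp only
          -- The summand `1` in `weight` gives `weight ν x + 1 ≤ 2 * weight ν x`.
          rw [weight_addPoint, ← mul_pow, two_mul]
          gcongr
          simp only [weight, ← add_assoc]
          exact le_add_self
      _ = (2 ^ a * ν Set.univ) * ∫⁻ x, weight ν x ^ a ∂Q := by
          simp only [lintegral_const]
          rw [← lintegral_const_mul _ hm]
          refine lintegral_congr fun x => ?_
          ring
      _ < ∞ := ENNReal.mul_lt_top (by finiteness) ih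

/-- Each difference costs one factor of the weight: integrated over the new point, the shifted term
yields `total` by Mecke's formula and the unshifted term yields the mass of `ν`. The exponent `a` is
kept general so that the induction can absorb these factors. -/
theorem IsPoissonProcess.lintegral_weight_pow_mul_iterDiff_le (n : ℕ) {F : Config X → ℝ}
    (hF : Measurable F) (a : ℕ) :
    ∫⁻ z, weight ν z.1 ^ a * ‖iterDiff n z.2 F z.1‖ₑ ∂(Q.prod (Measure.pi fun _ => ν))
      ≤ ∫⁻ x, weight ν x ^ (a + n) * ‖F x‖ₑ ∂Q := by
  induction n generalizing a with
  | zero =>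
    have hm : Measurable fun x : Config X => weight ν x ^ a * ‖F x‖ₑ :=
      (measurable_weight.pow_const a).mul hF.enorm
    rw [lintegral_prod _ (by exact (hm.comp measurable_fst).aemeasurable)]
    simp [iterDiff, Measure.pi_empty_univ]
  | succ n ih =>
    have hm : Measurable fun z : Config X × (Fin n → X) =>
        weight ν z.1 ^ a * ‖iterDiff n z.2 F z.1‖ₑ :=
      ((measurable_weight.comp measurable_fst).pow_const a).mul (measurable_iterDiff n hF).enorm
    calc ∫⁻ z, weight ν z.1 ^ a * ‖iterDiff (n + 1) z.2 F z.1‖ₑ ∂(Q.prod (Measure.pi fun _ => ν))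
        ≤ ∫⁻ z, (weight ν (addFirst n z).1 ^ a
              * ‖iterDiff n (addFirst n z).2 F (addFirst n z).1‖ₑ
            + weight ν (dropFirst n z).1 ^ a
              * ‖iterDiff n (dropFirst n z).2 F (dropFirst n z).1‖ₑ)
            ∂(Q.prod (Measure.pi fun _ => ν)) := by
          refine lintegral_mono fun z => ?_
          simp only
          have h1 : ‖iterDiff (n + 1) z.2 F z.1‖ₑ
              ≤ ‖iterDiff n (addFirst n z).2 F (addFirst n z).1‖ₑ
                + ‖iterDiff n (dropFirst n z).2 F (dropFirst n z).1‖ₑ := enorm_sub_le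
          refine (mul_le_mul_right h1 _).trans ?_
          rw [mul_add]
          gcongr
          -- The weight only grows when a point is added, so it may be evaluated at the shifted
          -- configuration, as Mecke's formula requires.
          · simp only [addFirst, weight_addPoint]
            exact le_self_add
          · exact le_rfl
      _ = ∫⁻ z, z.1.total * (weight ν z.1 ^ a * ‖iterDiff n z.2 F z.1‖ₑ)
              ∂(Q.prod (Measure.pi fun _ => ν))
          + ν Set.univ * ∫⁻ z, weight ν z.1 ^ a * ‖iterDiff n z.2 F z.1‖ₑ
              ∂(Q.prod (Measure.pi fun _ => ν)) := by
          rw [lintegral_add_right _ (by exact hm.comp (measurable_dropFirst n)),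
            ← hQ.lintegral_addFirst n hm, ← lintegral_dropFirst n hm]
      _ = ∫⁻ z, (z.1.total + ν Set.univ) * (weight ν z.1 ^ a * ‖iterDiff n z.2 F z.1‖ₑ)
              ∂(Q.prod (Measure.pi fun _ => ν)) := by
          rw [← lintegral_const_mul _ hm, ← lintegral_add_right _ (hm.const_mul _)]
          simp_rw [add_mul]
      _ ≤ ∫⁻ z, weight ν z.1 ^ (a + 1) * ‖iterDiff n z.2 F z.1‖ₑ
              ∂(Q.prod (Measure.pi fun _ => ν)) := by
          refine lintegral_mono fun z => ?_
          simp only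
          rw [pow_succ', mul_assoc]
          gcongr
          simp only [weight, ← add_assoc]
          exact le_self_add
      _ ≤ ∫⁻ x, weight ν x ^ (a + (n + 1)) * ‖F x‖ₑ ∂Q := by
          rw [show a + (n + 1) = a + 1 + n by ring]
          exact ih (a + 1)

/-- The iterated difference operators are bounded from `L₂` to `L₁`. -/
theorem IsPoissonProcess.eLpNorm_iterDiff_le (n : ℕ) {F : Config X → ℝ}
    (hF : AEStronglyMeasurable F Q) :
    eLpNorm (fun z : Config X × (Fin n → X) => iterDiff n z.2 F z.1) 1
        (Q.prod (Measure.pi fun _ => ν))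
      ≤ (∫⁻ x, weight ν x ^ (2 * n) ∂Q) ^ (1 / 2 : ℝ) * eLpNorm F 2 Q := by
  have hmk := hF.stronglyMeasurable_mk.measurable
  rw [eLpNorm_congr_ae hF.ae_eq_mk, eLpNorm_congr_ae (hQ.iterDiff_congr_ae n hF.ae_eq_mk),
    eLpNorm_one_eq_lintegral_enorm]
  have h1 := hQ.lintegral_weight_pow_mul_iterDiff_le n hmk 0
  simp only [pow_zero, one_mul, zero_add] at h1
  refine h1.trans ?_
  -- Cauchy–Schwarz separates `weight ν x ^ n` from `F`; this is where `L₂` is needed.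
  have h2 := ENNReal.lintegral_mul_le_Lp_mul_Lq Q Real.HolderConjugate.two_two
    (measurable_weight.pow_const n).aemeasurable hmk.enorm.aemeasurable (f := fun x => weight ν x ^ n)
  refine h2.trans (le_of_eq ?_)
  rw [eLpNorm_eq_lintegral_rpow_enorm_toReal (by simp) (by simp)]
  simp only [ENNReal.toReal_ofNat, ← ENNReal.rpow_natCast, ← ENNReal.rpow_mul]
  congr 4
  funext x
  congr 1
  push_cast
  ring

theorem IsPoissonProcess.integrable_iterDiff (n : ℕ) {F : Config X → ℝ} (hF : MemLp F 2 Q) :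
    Integrable (fun z : Config X × (Fin n → X) => iterDiff n z.2 F z.1)
      (Q.prod (Measure.pi fun _ => ν)) := by
  rw [← memLp_one_iff_integrable]
  refine ⟨hQ.aestronglyMeasurable_iterDiff n hF.1, (hQ.eLpNorm_iterDiff_le n hF.1).trans_lt ?_⟩
  exact ENNReal.mul_lt_top (ENNReal.rpow_lt_top_of_nonneg (by positivity)
    (hQ.lintegral_weight_pow_lt_top _).ne) hF.2

theorem IsPoissonProcess.ae_integrable_iterDiff (n : ℕ) {F : Config X → ℝ} (hF : MemLp F 2 Q) :
    ∀ᵐ y ∂(Measure.pi fun _ : Fin n => ν), Integrable (fun x => iterDiff n y F x) Q :=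
  (hQ.integrable_iterDiff n hF).prod_left_ae

theorem IsPoissonProcess.integrable_meanDiff (n : ℕ) {F : Config X → ℝ} (hF : MemLp F 2 Q) :
    Integrable (meanDiff Q id n F) (Measure.pi fun _ : Fin n => ν) :=
  (hQ.integrable_iterDiff n hF).integral_prod_right

theorem IsPoissonProcess.eLpNorm_meanDiff_le (n : ℕ) {F : Config X → ℝ} (hF : MemLp F 2 Q) :
    eLpNorm (meanDiff Q id n F) 1 (Measure.pi fun _ : Fin n => ν)
      ≤ (∫⁻ x, weight ν x ^ (2 * n) ∂Q) ^ (1 / 2 : ℝ) * eLpNorm F 2 Q := by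
  refine le_trans ?_ (hQ.eLpNorm_iterDiff_le n hF.1)
  rw [eLpNorm_one_eq_lintegral_enorm, eLpNorm_one_eq_lintegral_enorm,
    lintegral_prod_symm _ (hQ.integrable_iterDiff n hF).1.enorm]
  exact lintegral_mono fun y => enorm_integral_le_lintegral_enorm _

theorem IsPoissonProcess.meanDiff_congr (n : ℕ) {F G : Config X → ℝ} (h : F =ᵐ[Q] G) :
    meanDiff Q id n F =ᵐ[Measure.pi fun _ : Fin n => ν] meanDiff Q id n G := by
  have h1 := hQ.iterDiff_congr_ae n h
  have h2 : ∀ᵐ z ∂((Measure.pi fun _ : Fin n => ν).prod Q),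
      iterDiff n z.1 F z.2 = iterDiff n z.1 G z.2 :=
    (Measure.measurePreserving_swap (μ := Measure.pi fun _ : Fin n => ν)
      (ν := Q)).quasiMeasurePreserving.ae h1
  filter_upwards [Measure.ae_ae_of_ae_prod h2] with y hy
  exact integral_congr_ae hy

theorem IsPoissonProcess.meanDiff_add (n : ℕ) {F G : Config X → ℝ} (hF : MemLp F 2 Q)
    (hG : MemLp G 2 Q) :
    meanDiff Q id n (fun x => F x + G x)
      =ᵐ[Measure.pi fun _ : Fin n => ν] meanDiff Q id n F + meanDiff Q id n G := by
  filter_upwards [hQ.ae_integrable_iterDiff n hF, hQ.ae_integrable_iterDiff n hG] with y h1 h2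
  simp only [meanDiff, iterDiff_add, id, Pi.add_apply]
  exact integral_add h1 h2

end

theorem meanDiff_const_mul (n : ℕ) (c : ℝ) (F : Config X → ℝ) (y : Fin n → X) :
    meanDiff Q id n (fun x => c * F x) y = c * meanDiff Q id n F y := by
  simp only [meanDiff, iterDiff_const_mul, id, integral_const_mul]

end PoissonFunctionals

/-! ### Exponential functionals: the isometry and density -/

namespace PoissonFunctionals

variable {X : Type*} [MeasurableSpace X] {ν : Measure X} {Q : Measure (Config X)}

/-- Exponential functionals are eigenfunctions of every `D_y`, with eigenvalue `exp (-g y) - 1`, so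
their `Tₙ` are tensor powers. -/
theorem iterDiff_expFunctional (g : SimpleFunc X ℝ≥0) (n : ℕ) (y : Fin n → X) (x : Config X) :
    iterDiff n y (expFunctional g) x
      = (∏ i, (Real.exp (-(g (y i) : ℝ)) - 1)) * expFunctional g x := by
  induction n generalizing x with
  | zero => simp [iterDiff]
  | succ n ih =>
    rw [iterDiff_succ, ih, ih, expFunctional_addPoint, Fin.prod_univ_succ]
    simp only [Fin.tail]
    ring

theorem meanDiff_expFunctional (g : SimpleFunc X ℝ≥0) (n : ℕ) (y : Fin n → X) :
    meanDiff Q id n (expFunctional g) y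
      = (∏ i, (Real.exp (-(g (y i) : ℝ)) - 1)) * ∫ x, expFunctional g x ∂Q := by
  simp only [meanDiff, iterDiff_expFunctional, id, integral_const_mul]

theorem measurable_exp_sub_one (g : SimpleFunc X ℝ≥0) :
    Measurable fun y => Real.exp (-(g y : ℝ)) - 1 := by
  have hg : Measurable fun y => (g y : ℝ) := g.measurable.coe_nnreal_real
  fun_prop

theorem norm_exp_sub_one_le (g : SimpleFunc X ℝ≥0) (y : X) :
    ‖Real.exp (-(g y : ℝ)) - 1‖ ≤ 1 := by
  have h1 := Real.exp_pos (-(g y : ℝ))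
  have h2 : Real.exp (-(g y : ℝ)) ≤ 1 := by simp
  rw [Real.norm_eq_abs, abs_le]
  constructor <;> linarith

theorem memLp_expFunctional [IsFiniteMeasure Q] (g : SimpleFunc X ℝ≥0) :
    MemLp (expFunctional g) 2 Q :=
  .of_bound (measurable_expFunctional g).aestronglyMeasurable 1
    (.of_forall (norm_expFunctional_le g))

theorem memLp_meanDiff_expFunctional [IsFiniteMeasure ν] (g : SimpleFunc X ℝ≥0) (n : ℕ) :
    MemLp (meanDiff Q id n (expFunctional g)) 2 (Measure.pi fun _ : Fin n => ν) := by
  have h : meanDiff Q id n (expFunctional g)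
      = fun y => (∏ i, (Real.exp (-(g (y i) : ℝ)) - 1)) * ∫ x, expFunctional g x ∂Q :=
    funext (meanDiff_expFunctional g n)
  rw [h]
  refine MemLp.mul_const (.of_bound (Measurable.aestronglyMeasurable ?_) 1 (.of_forall ?_)) _
  · exact Finset.measurable_fun_prod _ fun i _ =>
      (measurable_exp_sub_one g).comp (measurable_pi_apply i)
  · intro y
    rw [norm_prod]
    exact Finset.prod_le_one (fun _ _ => norm_nonneg _) fun i _ => norm_exp_sub_one_le g _

theorem integral_meanDiff_expFunctional_mul [IsFiniteMeasure ν] (g h : SimpleFunc X ℝ≥0) (n : ℕ) :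
    ∫ y, meanDiff Q id n (expFunctional g) y * meanDiff Q id n (expFunctional h) y
        ∂(Measure.pi fun _ : Fin n => ν)
      = (∫ y, (Real.exp (-(g y : ℝ)) - 1) * (Real.exp (-(h y : ℝ)) - 1) ∂ν) ^ n
        * ((∫ x, expFunctional g x ∂Q) * ∫ x, expFunctional h x ∂Q) := by
  have h0 : ∀ y : Fin n → X,
      meanDiff Q id n (expFunctional g) y * meanDiff Q id n (expFunctional h) y
        = (∏ i, (Real.exp (-(g (y i) : ℝ)) - 1) * (Real.exp (-(h (y i) : ℝ)) - 1))
          * ((∫ x, expFunctional g x ∂Q) * ∫ x, expFunctional h x ∂Q) := by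
    intro y
    rw [meanDiff_expFunctional, meanDiff_expFunctional, mul_mul_mul_comm,
      ← Finset.prod_mul_distrib]
  rw [integral_congr_ae (.of_forall h0), integral_mul_const,
    integral_fintype_prod_eq_pow (ι := Fin n)
    (fun y => (Real.exp (-(g y : ℝ)) - 1) * (Real.exp (-(h y : ℝ)) - 1)), Fintype.card_fin]

/-- The isometry property of the Fock space representation, for exponential functionals. -/
theorem IsPoissonProcess.hasSum_expFunctional [IsFiniteMeasure ν] (hQ : IsPoissonProcess ν Q id)
    (g h : SimpleFunc X ℝ≥0) :
    HasSum (fun n : ℕ => (n.factorial : ℝ)⁻¹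
        * ∫ y, meanDiff Q id n (expFunctional g) y * meanDiff Q id n (expFunctional h) y
          ∂(Measure.pi fun _ : Fin n => ν))
      (∫ x, expFunctional g x * expFunctional h x ∂Q) := by
  simp only [integral_meanDiff_expFunctional_mul]
  set a := ∫ y, (Real.exp (-(g y : ℝ)) - 1) * (Real.exp (-(h y : ℝ)) - 1) ∂ν with ha
  have h1 := (NormedSpace.expSeries_div_hasSum_exp a).mul_right
    ((∫ x, expFunctional g x ∂Q) * ∫ x, expFunctional h x ∂Q)
  rw [← Real.exp_eq_exp_ℝ] at h1
  have h2 : ∫ x, expFunctional g x * expFunctional h x ∂Q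
      = Real.exp a * ((∫ x, expFunctional g x ∂Q) * ∫ x, expFunctional h x ∂Q) := by
    -- With `u = exp (-g) - 1` and `v = exp (-h) - 1` the claim reduces to `exp (-(g + h)) - 1 = u v
    -- + u + v`, integrated against `ν` and exponentiated.
    rw [← integral_congr_ae (.of_forall (expFunctional_add g h)), hQ.integral_expFunctional,
      hQ.integral_expFunctional, hQ.integral_expFunctional, ← Real.exp_add, ← Real.exp_add]
    congr 1
    have hint : ∀ g : SimpleFunc X ℝ≥0, Integrable (fun y => Real.exp (-(g y : ℝ)) - 1) ν :=
      fun g => .of_bound (measurable_exp_sub_one g).aestronglyMeasurable 1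
        (.of_forall (norm_exp_sub_one_le g))
    have hneg : ∀ g : SimpleFunc X ℝ≥0, -∫ y, (1 - Real.exp (-(g y : ℝ))) ∂ν
        = ∫ y, (Real.exp (-(g y : ℝ)) - 1) ∂ν := by
      intro g
      rw [← integral_neg]
      simp
    have hgh : Integrable
        (fun y => (Real.exp (-(g y : ℝ)) - 1) * (Real.exp (-(h y : ℝ)) - 1)) ν := by
      refine .of_bound ((measurable_exp_sub_one g).mul
        (measurable_exp_sub_one h)).aestronglyMeasurable 1 (.of_forall fun y => ?_)
      rw [norm_mul]
      exact mul_le_one₀ (norm_exp_sub_one_le g y) (norm_nonneg _) (norm_exp_sub_one_le h y)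
    rw [hneg, hneg, hneg, ha, ← integral_add (hint g) (hint h),
      ← integral_add hgh (show Integrable (fun y => Real.exp (-(g y : ℝ)) - 1
        + (Real.exp (-(h y : ℝ)) - 1)) ν from (hint g).add (hint h))]
    refine integral_congr_ae (.of_forall fun y => ?_)
    simp only [SimpleFunc.coe_add, Pi.add_apply, NNReal.coe_add, neg_add, Real.exp_add]
    ring
  rw [h2]
  refine h1.congr_fun fun n => ?_
  ring

/-- If `f` is orthogonal to all exponential functionals, its positive and negative parts are
densities of two finite measures with the same Laplace functional. The measures are then equal, so
the two parts agree almost everywhere, and both vanish. -/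
theorem dense_span_expFunctional [IsFiniteMeasure Q] :
    (Submodule.span ℝ (Set.range fun g : SimpleFunc X ℝ≥0 =>
      (memLp_expFunctional (Q := Q) g).toLp)).topologicalClosure = ⊤ := by
  rw [Submodule.topologicalClosure_eq_top_iff, Submodule.eq_bot_iff]
  intro f hf
  rw [Submodule.mem_orthogonal] at hf
  have hfi : Integrable f Q := (Lp.memLp f).integrable (by norm_num)
  have hfm : Measurable f := (Lp.stronglyMeasurable f).measurable
  have h0 : ∀ g : SimpleFunc X ℝ≥0, ∫ x, expFunctional g x * f x ∂Q = 0 := by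
    intro g
    have := hf _ (Submodule.subset_span ⟨g, rfl⟩)
    rw [L2.inner_def] at this
    rw [← this]
    refine integral_congr_ae ?_
    filter_upwards [(memLp_expFunctional (Q := Q) g).coeFn_toLp] with x hx
    simp only [hx, inner]
    simp [mul_comm]
  have := isFiniteMeasure_withDensity_ofReal hfi.2
  have : IsFiniteMeasure (Q.withDensity fun x => ENNReal.ofReal (-f x)) :=
    isFiniteMeasure_withDensity_ofReal hfi.neg.2
  have hint : ∀ (g : SimpleFunc X ℝ≥0) (u : Config X → ℝ), Integrable u Q →
      Integrable (fun x => expFunctional g x * u x) Q := fun g u hu =>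
    hu.bdd_mul (measurable_expFunctional g).aestronglyMeasurable (c := 1)
      (.of_forall (norm_expFunctional_le g))
  have hM : Q.withDensity (fun x => ENNReal.ofReal (f x))
      = Q.withDensity (fun x => ENNReal.ofReal (-f x)) := by
    refine measure_ext_of_integral_expFunctional fun g => ?_
    rw [integral_withDensity_eq_integral_toReal_smul (by fun_prop) (by simp),
      integral_withDensity_eq_integral_toReal_smul
        (by exact (hfm.neg).ennreal_ofReal) (by simp), ← sub_eq_zero, ← h0 g, ← integral_sub]
    · refine integral_congr_ae (.of_forall fun x => ?_)
      simp only [ENNReal.toReal_ofReal', smul_eq_mul]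
      rcases le_total (f x) 0 with h | h
      · simp [max_eq_right h, max_eq_left (neg_nonneg.2 h)]; ring
      · simp [max_eq_left h, max_eq_right (neg_nonpos.2 h)]; ring
    · simp only [ENNReal.toReal_ofReal', smul_eq_mul, mul_comm _ (expFunctional g _)]
      exact hint g _ hfi.pos_part
    · simp only [ENNReal.toReal_ofReal', smul_eq_mul, mul_comm _ (expFunctional g _)]
      exact hint g _ hfi.neg.pos_part
  rw [withDensity_eq_iff (by fun_prop) (by exact (hfm.neg).ennreal_ofReal.aemeasurable)
    hfi.lintegral_lt_top.ne] at hM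
  rw [Lp.eq_zero_iff_ae_eq_zero]
  filter_upwards [hM] with x hx
  rcases le_total (f x) 0 with h | h
  · rw [ENNReal.ofReal_of_nonpos h] at hx
    have := ENNReal.ofReal_eq_zero.1 hx.symm
    simp only [Pi.zero_apply] at this ⊢
    linarith
  · rw [ENNReal.ofReal_of_nonpos (show -f x ≤ 0 by simpa using h)] at hx
    have := ENNReal.ofReal_eq_zero.1 hx
    simp only [Pi.zero_apply]
    linarith

end PoissonFunctionals

/-! ### Continuous linear maps between `L₂`, `L₁` and Hilbert sums -/

open scoped InnerProductSpace in
/-- A map between families of vectors that preserves inner products extends to an isometry, when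
the first family spans a dense subspace. -/
theorem exists_clm_of_inner_eq {ι H K : Type*} [NormedAddCommGroup H] [InnerProductSpace ℝ H]
    [NormedAddCommGroup K] [InnerProductSpace ℝ K] [CompleteSpace K] (v : ι → H) (w : ι → K)
    (hvw : ∀ i j, ⟪v i, v j⟫_ℝ = ⟪w i, w j⟫_ℝ)
    (hd : (Submodule.span ℝ (Set.range v)).topologicalClosure = ⊤) :
    ∃ T : H →L[ℝ] K, (∀ i, T (v i) = w i) ∧ ∀ x y, ⟪T x, T y⟫_ℝ = ⟪x, y⟫_ℝ := by
  let e := Finsupp.linearCombination ℝ v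
  let f := Finsupp.linearCombination ℝ w
  have hin : ∀ a b : ι →₀ ℝ, ⟪f a, f b⟫_ℝ = ⟪e a, e b⟫_ℝ := by
    intro a b
    simp only [e, f, Finsupp.linearCombination_apply, Finsupp.sum_inner, Finsupp.inner_sum,
      real_inner_smul_left, real_inner_smul_right, hvw]
  have hnorm : ∀ a, ‖f a‖ ≤ 1 * ‖e a‖ := by
    intro a
    rw [one_mul, norm_eq_sqrt_real_inner, norm_eq_sqrt_real_inner (e a), hin]
  have hdense : DenseRange e := by
    rw [DenseRange, ← LinearMap.coe_range, Finsupp.range_linearCombination]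
    exact Submodule.dense_iff_topologicalClosure_eq_top.2 hd
  -- The norm bound makes `f` constant on the fibers of `e`, so it descends to the dense range of
  -- `e` and extends by continuity.
  have hT : ∀ a, f.extendOfNorm e (e a) = f a := LinearMap.extendOfNorm_eq hdense ⟨1, hnorm⟩
  refine ⟨f.extendOfNorm e, fun i => ?_, fun x y => ?_⟩
  · simpa [e, f] using hT (Finsupp.single i 1)
  · induction x, y using hdense.induction_on₂ with
    | hp => exact isClosed_eq (by fun_prop) (by fun_prop)
    | h a b => rw [hT, hT, hin]

/-- On a finite measure space, `L₂` embeds into `L₁`. -/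
theorem MeasureTheory.Lp.exists_clm_two_one {α : Type*} [MeasurableSpace α] (M : Measure α)
    [IsFiniteMeasure M] : ∃ J : Lp ℝ 2 M →L[ℝ] Lp ℝ 1 M, ∀ f, J f =ᵐ[M] f := by
  have hmem : ∀ f : Lp ℝ 2 M, MemLp f 1 M := fun f => (Lp.memLp f).mono_exponent (by norm_num)
  let L : Lp ℝ 2 M →ₗ[ℝ] Lp ℝ 1 M :=
    { toFun := fun f => (hmem f).toLp
      map_add' := fun f g => by
        rw [← MemLp.toLp_add, MemLp.toLp_eq_toLp_iff]
        exact Lp.coeFn_add f g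
      map_smul' := fun c f => by
        rw [RingHom.id_apply, ← MemLp.toLp_const_smul, MemLp.toLp_eq_toLp_iff]
        exact Lp.coeFn_smul c f }
  let C := M Set.univ ^ (1 / (1 : ℝ≥0∞).toReal - 1 / (2 : ℝ≥0∞).toReal)
  have hC : C ≠ ∞ := ENNReal.rpow_ne_top_of_nonneg (by norm_num) (measure_ne_top _ _)
  refine ⟨L.mkContinuous C.toReal fun f => ?_, fun f => (hmem f).coeFn_toLp⟩
  change ‖(hmem f).toLp‖ ≤ _
  rw [Lp.norm_toLp, Lp.norm_def, ← ENNReal.toReal_mul, mul_comm]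
  exact ENNReal.toReal_mono (ENNReal.mul_ne_top (Lp.eLpNorm_ne_top f) hC)
    (eLpNorm_le_eLpNorm_mul_rpow_measure_univ (by norm_num) (Lp.memLp f).1)

theorem lp.exists_clm_apply {ι : Type*} (E : ι → Type*) [∀ i, NormedAddCommGroup (E i)]
    [∀ i, NormedSpace ℝ (E i)] (i : ι) : ∃ J : lp E 2 →L[ℝ] E i, ∀ f, J f = f i :=
  ⟨LinearMap.mkContinuous
    { toFun := fun f : lp E 2 => f i
      map_add' := fun _ _ => rfl
      map_smul' := fun _ _ => rfl } 1 fun f => by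
        rw [one_mul]
        exact lp.norm_apply_le_norm (by norm_num) f i, fun _ => rfl⟩

/-! ### The Fock space representation -/

namespace PoissonFunctionals

variable {X : Type*} [MeasurableSpace X] {ν : Measure X} {Q : Measure (Config X)}

/-- The `n`-th level of the Fock space over `L₂(ν)` (without symmetrization). -/
abbrev FockLevel (ν : Measure X) (n : ℕ) : Type _ := Lp ℝ 2 (Measure.pi fun _ : Fin n => ν)

theorem inner_toLp {α : Type*} [MeasurableSpace α] {M : Measure α} {f g : α → ℝ}
    (hf : MemLp f 2 M) (hg : MemLp g 2 M) :
    inner ℝ hf.toLp hg.toLp = ∫ x, f x * g x ∂M := by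
  rw [L2.inner_def]
  refine integral_congr_ae ?_
  filter_upwards [hf.coeFn_toLp, hg.coeFn_toLp] with x h1 h2
  simp only [h1, h2, inner]
  simp [mul_comm]

section

variable [IsProbabilityMeasure Q] [IsFiniteMeasure ν] (hQ : IsPoissonProcess ν Q id)
include hQ

/-- `T_n` as a bounded linear operator from `L₂` to `L₁`. -/
theorem IsPoissonProcess.exists_clm_meanDiff (n : ℕ) :
    ∃ A : Lp ℝ 2 Q →L[ℝ] Lp ℝ 1 (Measure.pi fun _ : Fin n => ν),
      ∀ F : Config X → ℝ, ∀ hF : MemLp F 2 Q,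
        A hF.toLp =ᵐ[Measure.pi fun _ => ν] meanDiff Q id n F := by
  have hmem : ∀ f : Lp ℝ 2 Q,
      MemLp (meanDiff Q id n f) 1 (Measure.pi fun _ : Fin n => ν) := fun f =>
    memLp_one_iff_integrable.2 (hQ.integrable_meanDiff n (Lp.memLp f))
  let C := (∫⁻ x, weight ν x ^ (2 * n) ∂Q) ^ (1 / 2 : ℝ)
  have hC : C ≠ ∞ := (ENNReal.rpow_lt_top_of_nonneg (by positivity)
    (hQ.lintegral_weight_pow_lt_top _).ne).ne
  let L : Lp ℝ 2 Q →ₗ[ℝ] Lp ℝ 1 (Measure.pi fun _ : Fin n => ν) :=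
    { toFun := fun f => (hmem f).toLp
      map_add' := fun f g => by
        rw [← MemLp.toLp_add, MemLp.toLp_eq_toLp_iff]
        exact (hQ.meanDiff_congr n (Lp.coeFn_add f g)).trans
          (hQ.meanDiff_add n (Lp.memLp f) (Lp.memLp g))
      map_smul' := fun c f => by
        rw [RingHom.id_apply, ← MemLp.toLp_const_smul, MemLp.toLp_eq_toLp_iff]
        refine (hQ.meanDiff_congr n (Lp.coeFn_smul c f)).trans (.of_forall fun y => ?_)
        exact meanDiff_const_mul n c f y }
  refine ⟨L.mkContinuous C.toReal fun f => ?_, fun F hF => ?_⟩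
  · change ‖(hmem f).toLp‖ ≤ _
    rw [Lp.norm_toLp, Lp.norm_def, ← ENNReal.toReal_mul]
    exact ENNReal.toReal_mono (ENNReal.mul_ne_top hC (Lp.eLpNorm_ne_top f))
      (hQ.eLpNorm_meanDiff_le n (Lp.memLp f))
  · exact (hmem hF.toLp).coeFn_toLp.trans (hQ.meanDiff_congr n hF.coeFn_toLp)

/-- The Fock space representation of the space `L₂` of a Poisson process. -/
theorem IsPoissonProcess.fock {F G : Config X → ℝ} (hF : MemLp F 2 Q) (hG : MemLp G 2 Q) :
    (∀ n, MemLp (meanDiff Q id n F) 2 (Measure.pi fun _ : Fin n => ν)) ∧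
    HasSum (fun n : ℕ => (n.factorial : ℝ)⁻¹ * ∫ y, meanDiff Q id n F y * meanDiff Q id n G y
        ∂(Measure.pi fun _ : Fin n => ν))
      (∫ x, F x * G x ∂Q) := by
  -- This scaling of level `n` absorbs the weight `1/n!` into the ordinary inner product of the
  -- Hilbert sum.
  let s : ℕ → ℝ := fun n => (Real.sqrt n.factorial)⁻¹
  have hs : ∀ n, s n ≠ 0 := fun n => by
    have : 0 < Real.sqrt n.factorial := Real.sqrt_pos.2 (by positivity)
    positivity
  have hs2 : ∀ n, s n * s n = (n.factorial : ℝ)⁻¹ := fun n => by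
    rw [← mul_inv, Real.mul_self_sqrt (by positivity)]
  let w₀ : SimpleFunc X ℝ≥0 → (n : ℕ) → FockLevel ν n := fun g n =>
    s n • (memLp_meanDiff_expFunctional (Q := Q) g n).toLp
  have hin : ∀ g h n, inner ℝ (w₀ g n) (w₀ h n) = (n.factorial : ℝ)⁻¹
      * ∫ y, meanDiff Q id n (expFunctional g) y * meanDiff Q id n (expFunctional h) y
        ∂(Measure.pi fun _ : Fin n => ν) := by
    intro g h n
    rw [real_inner_smul_left, real_inner_smul_right, ← mul_assoc, hs2, inner_toLp]
  have hw : ∀ g, Memℓp (w₀ g) 2 := by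
    intro g
    refine memℓp_gen ?_
    have h1 := (hQ.hasSum_expFunctional g g).summable
    refine h1.congr fun n => ?_
    rw [← hin g g n, real_inner_self_eq_norm_sq]
    simp
  obtain ⟨T, hTv, hTin⟩ := exists_clm_of_inner_eq
    (fun g : SimpleFunc X ℝ≥0 => (memLp_expFunctional (Q := Q) g).toLp)
    (fun g => (⟨w₀ g, hw g⟩ : lp (FockLevel ν) 2))
    (fun g h => by
      rw [lp.inner_eq_tsum, inner_toLp]
      simp only [hin]
      exact (hQ.hasSum_expFunctional g h).tsum_eq.symm) dense_span_expFunctional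
  have hTn : ∀ {F : Config X → ℝ} (hF : MemLp F 2 Q) (n : ℕ),
      (T hF.toLp n : (Fin n → X) → ℝ) =ᵐ[Measure.pi fun _ => ν]
        fun y => s n * meanDiff Q id n F y := by
    intro F hF n
    obtain ⟨A, hA⟩ := hQ.exists_clm_meanDiff n
    obtain ⟨J, hJ⟩ := Lp.exists_clm_two_one (Measure.pi fun _ : Fin n => ν)
    obtain ⟨V, hV⟩ := lp.exists_clm_apply (FockLevel ν) n
    -- Both sides are continuous from `L₂(Q)` to `L₁` and agree on exponential functionals, hence
    -- everywhere. This identifies level `n` of the abstract extension `T` with `Tₙ`, and thereby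
    -- places `Tₙ F` in `L₂`.
    have hAB : s n • A = J.comp (V.comp T) := by
      refine ContinuousLinearMap.ext_on
        (Submodule.dense_iff_topologicalClosure_eq_top.2 dense_span_expFunctional) ?_
      rintro _ ⟨g, rfl⟩
      simp only [ContinuousLinearMap.comp_apply, hTv, hV, smul_apply]
      refine Lp.ext ?_
      filter_upwards [Lp.coeFn_smul (s n) (A (memLp_expFunctional (Q := Q) g).toLp),
        hA _ (memLp_expFunctional (Q := Q) g), hJ (w₀ g n),
        Lp.coeFn_smul (s n) (memLp_meanDiff_expFunctional (ν := ν) (Q := Q) g n).toLp,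
        (memLp_meanDiff_expFunctional (ν := ν) (Q := Q) g n).coeFn_toLp] with y h1 h2 h3 h4 h5
      rw [h1, h3, h4]
      simp only [Pi.smul_apply, h2, h5]
    have h0 : J (T hF.toLp n) = s n • A hF.toLp := by
      rw [← hV, ← smul_apply, hAB]
      rfl
    filter_upwards [hJ (T hF.toLp n), Lp.coeFn_smul (s n) (A hF.toLp), hA F hF] with y h1 h2 h3
    rw [← h1, h0, h2]
    simp [h3]
  refine ⟨fun n => ?_, ?_⟩
  · refine (((Lp.memLp (T hF.toLp n)).ae_eq (hTn hF n)).const_mul (s n)⁻¹).ae_eq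
      (.of_forall fun y => ?_)
    exact inv_mul_cancel_left₀ (hs n) _
  · have h1 := lp.hasSum_inner (𝕜 := ℝ) (T hF.toLp) (T hG.toLp)
    rw [hTin, inner_toLp] at h1
    refine h1.congr_fun fun n => ?_
    rw [L2.inner_def, ← integral_const_mul]
    refine integral_congr_ae ?_
    filter_upwards [hTn hF n, hTn hG n] with y h1 h2
    simp only [h1, h2, inner, ← hs2, star_trivial, RCLike.re_to_real]
    ring

end

end PoissonFunctionals

/-! ### Functionals of finite degree and vanishing of high differences -/

namespace PoissonFunctionals

variable {X : Type*} [MeasurableSpace X] {ν : Measure X} {Q : Measure (Config X)}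

section Degree

variable [MeasurableSingletonClass X]

/-- The points of a configuration, as a finset. -/
noncomputable def Config.support (x : Config X) : Finset X := x.finite_points.toFinset

theorem Config.mem_support {x : Config X} {y : X} : y ∈ x.support ↔ x.1 {y} ≠ 0 := by
  simp [Config.support, Config.points]

open scoped Classical in
theorem Config.support_addPoint (x : Config X) (y : X) :
    (x.addPoint y).support = insert y x.support := by
  ext z
  rw [Finset.mem_insert, Config.mem_support, Config.mem_support]
  have : (x.addPoint y).1 {z} = x.1 {z} + Set.indicator {z} 1 y := by
    simp [Config.addPoint, Measure.dirac_apply' y (measurableSet_singleton z)]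
  rw [this]
  by_cases h : z = y
  · simp [h]
  · simp [h, Ne.symm h]

/-- `F(x)` is a sum, over the subsets of at most `q` points of `x`, of terms that depend only on
the subset. -/
def HasDegreeLE (q : ℕ) (F : Config X → ℝ) : Prop :=
  ∃ c : Finset X → ℝ, (∀ K, q < K.card → c K = 0) ∧
    ∀ x : Config X, F x = ∑ K ∈ x.support.powerset, c K

/-- Group the tuples by their image, a set of at most `k` points. -/
theorem IsUStatistic.hasDegreeLE {k : ℕ} {F : Config X → ℝ} (hF : IsUStatistic ν k F) :
    HasDegreeLE k F := by
  classical
  obtain ⟨f, -, -, -, hf⟩ := hF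
  refine ⟨fun K => ∑ᶠ t ∈ {t : Fin k → X | Function.Injective t ∧ Finset.univ.image t = K}, f t,
    fun K hK => ?_, fun x => ?_⟩
  · have : {t : Fin k → X | Function.Injective t ∧ Finset.univ.image t = K} = ∅ := by
      ext t
      simp only [Set.mem_ofPred_eq, Set.mem_empty_iff_false, iff_false, not_and]
      rintro - rfl
      exact absurd (Finset.card_image_le.trans (by simp)) (not_le.2 hK)
    simp only
    rw [this, finsum_mem_empty]
  · rw [hf, finsum_mem_eq_finite_toFinset_sum _ (x.finite_tuples k)]
    have hmaps : ∀ t ∈ (x.finite_tuples k).toFinset, Finset.univ.image t ∈ x.support.powerset := by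
      intro t ht
      rw [Set.Finite.mem_toFinset] at ht
      rw [Finset.mem_powerset]
      intro z hz
      obtain ⟨i, -, rfl⟩ := Finset.mem_image.1 hz
      exact x.finite_points.mem_toFinset.2 (ht.2 i)
    rw [← Finset.sum_fiberwise_of_maps_to hmaps]
    refine Finset.sum_congr rfl fun K hK => ?_
    rw [← finsum_mem_coe_finset]
    refine finsum_mem_congr (Set.ext fun t => ?_) fun _ _ => rfl
    simp only [Finset.coe_filter, Set.Finite.mem_toFinset, Set.mem_ofPred_eq]
    constructor
    · rintro ⟨h1, h2⟩
      exact ⟨h1.1, h2⟩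
    · rintro ⟨h1, rfl⟩
      refine ⟨⟨h1, fun i => ?_⟩, rfl⟩
      exact x.finite_points.mem_toFinset.1 (Finset.mem_powerset.1 hK
        (Finset.mem_image_of_mem _ (Finset.mem_univ i)))

/-- Expand the product and group the pairs `(K, L)` by their union. If the union has more than `a +
b` points, then `K` has more than `a` or `L` more than `b`, and the term vanishes. -/
theorem HasDegreeLE.mul {a b : ℕ} {F G : Config X → ℝ} (hF : HasDegreeLE a F)
    (hG : HasDegreeLE b G) : HasDegreeLE (a + b) fun x => F x * G x := by
  classical
  obtain ⟨c, hc, hF⟩ := hF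
  obtain ⟨d, hd, hG⟩ := hG
  refine ⟨fun M => ∑ K ∈ (M.powerset ×ˢ M.powerset).filter (fun K => K.1 ∪ K.2 = M),
    c K.1 * d K.2, fun M hM => ?_, fun x => ?_⟩
  · refine Finset.sum_eq_zero fun K hK => ?_
    have h1 : K.1 ∪ K.2 = M := (Finset.mem_filter.1 hK).2
    have h2 := Finset.card_union_le K.1 K.2
    rw [h1] at h2
    rcases lt_or_ge a K.1.card with h | h
    · rw [hc _ h, zero_mul]
    · rw [hd _ (by omega), mul_zero]
  · simp only
    rw [hF, hG, Finset.sum_mul_sum, ← Finset.sum_product']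
    rw [← Finset.sum_fiberwise_of_maps_to (s := x.support.powerset ×ˢ x.support.powerset)
      (t := x.support.powerset) (g := fun K => K.1 ∪ K.2)]
    · refine Finset.sum_congr rfl fun M hM => Finset.sum_congr ?_ fun _ _ => rfl
      ext K
      simp only [Finset.mem_filter, Finset.mem_product, Finset.mem_powerset] at hM ⊢
      constructor
      · rintro ⟨-, rfl⟩
        exact ⟨⟨Finset.subset_union_left, Finset.subset_union_right⟩, rfl⟩
      · rintro ⟨⟨h1, h2⟩, h3⟩
        exact ⟨⟨h1.trans hM, h2.trans hM⟩, h3⟩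
    · intro K hK
      simp only [Finset.mem_product, Finset.mem_powerset] at hK ⊢
      exact Finset.union_subset hK.1 hK.2

theorem HasDegreeLE.prod {ι : Type*} (s : Finset ι) {k : ι → ℕ} {F : ι → Config X → ℝ}
    (hF : ∀ j ∈ s, HasDegreeLE (k j) (F j)) :
    HasDegreeLE (∑ j ∈ s, k j) fun x => ∏ j ∈ s, F j x := by
  classical
  induction s using Finset.induction_on with
  | empty =>
    refine ⟨fun K => if K = ∅ then 1 else 0, fun K hK => ?_, fun x => ?_⟩
    · simp only
      rw [if_neg (Finset.card_pos.1 (by simpa using hK)).ne_empty]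
    · simp
  | insert j s hj ih =>
    simp only [Finset.sum_insert hj, Finset.prod_insert hj]
    exact (hF j (Finset.mem_insert_self j s)).mul
      (ih fun i hi => hF i (Finset.mem_insert_of_mem hi))

-- Adding a new point `y 0` creates exactly the subsets that contain it, so the difference in `y 0`
-- cancels all the others; iterating leaves the subsets that contain every `y i`.
open scoped Classical in
theorem iterDiff_eq_sum {F : Config X → ℝ} {c : Finset X → ℝ}
    (hF : ∀ x : Config X, F x = ∑ K ∈ x.support.powerset, c K) (n : ℕ) (y : Fin n → X)
    (hy : Function.Injective y) (x : Config X) (hx : ∀ i, y i ∉ x.support) :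
    iterDiff n y F x = ∑ K ∈ (x.support ∪ Finset.univ.image y).powerset with
      Finset.univ.image y ⊆ K, c K := by
  induction n generalizing x with
  | zero => simp [iterDiff, hF]
  | succ n ih =>
    have hinj : Function.Injective (Fin.tail y) := fun i j h => Fin.succ_injective _ (hy h)
    have h0 : ∀ i, Fin.tail y i ≠ y 0 := fun i h => Fin.succ_ne_zero i (hy h)
    have himg : Finset.univ.image y = insert (y 0) (Finset.univ.image (Fin.tail y)) := by
      ext z
      simp only [Finset.mem_image, Finset.mem_univ, true_and, Finset.mem_insert,
        Fin.exists_fin_succ, Fin.tail, eq_comm]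
    have h0' : y 0 ∉ x.support ∪ Finset.univ.image (Fin.tail y) := by
      simp only [Finset.mem_union, hx 0, Finset.mem_image, Finset.mem_univ, true_and, false_or,
        not_exists]
      exact h0
    rw [iterDiff_succ, ih (Fin.tail y) hinj x (fun i => hx i.succ), ih (Fin.tail y) hinj _
      (fun i => by
        rw [Config.support_addPoint, Finset.mem_insert, not_or]
        exact ⟨h0 i, hx i.succ⟩), Config.support_addPoint, himg, Finset.union_insert,
      Finset.insert_union, sub_eq_iff_eq_add]
    set A := x.support ∪ Finset.univ.image (Fin.tail y)
    set Y := Finset.univ.image (Fin.tail y)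
    rw [← Finset.sum_filter_add_sum_filter_not _ (fun K => y 0 ∈ K)]
    congr 1
    · refine Finset.sum_congr ?_ fun _ _ => rfl
      ext K
      simp only [Finset.mem_filter, Finset.insert_subset_iff]
      tauto
    · refine Finset.sum_congr ?_ fun _ _ => rfl
      ext K
      simp only [Finset.mem_filter, Finset.mem_powerset]
      constructor
      · rintro ⟨⟨h1, h2⟩, h3⟩
        exact ⟨(Finset.subset_insert_iff_of_notMem h3).1 h1, h2⟩
      · rintro ⟨h1, h2⟩
        exact ⟨⟨h1.trans (Finset.subset_insert _ _), h2⟩, fun h => h0' (h1 h)⟩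

theorem HasDegreeLE.iterDiff_eq_zero {q : ℕ} {F : Config X → ℝ} (hF : HasDegreeLE q F) {n : ℕ}
    (hn : q < n) {y : Fin n → X} (hy : Function.Injective y) {x : Config X}
    (hx : ∀ i, y i ∉ x.support) : iterDiff n y F x = 0 := by
  classical
  obtain ⟨c, hc, hF⟩ := hF
  rw [iterDiff_eq_sum hF n y hy x hx]
  refine Finset.sum_eq_zero fun K hK => hc K ?_
  have h1 := Finset.card_le_card (Finset.mem_filter.1 hK).2
  rw [Finset.card_image_of_injective _ hy, Finset.card_univ, Fintype.card_fin] at h1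
  omega

end Degree

/-- By Fubini it suffices that, given the other coordinates, a further one avoids their finite
range; this range is a null set because `ν` has no atoms. -/
theorem ae_injective_pi [MeasurableEq X] [MeasurableSingletonClass X] [IsFiniteMeasure ν]
    [NullSingletonClass ν] (n : ℕ) :
    ∀ᵐ y ∂(Measure.pi fun _ : Fin n => ν), Function.Injective y := by
  induction n with
  | zero => exact .of_forall fun y => Function.injective_of_subsingleton y
  | succ n ih =>
    have h1 : ∀ᵐ z ∂(ν.prod (Measure.pi fun _ : Fin n => ν)), z.1 ∉ Set.range z.2 := by
      have hm : MeasurableSet {z : (Fin n → X) × X | z.2 ∉ Set.range z.1} := by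
        have : {z : (Fin n → X) × X | z.2 ∉ Set.range z.1}
            = ⋂ i : Fin n, {z | z.1 i = z.2}ᶜ := by
          ext z
          simp
        rw [this]
        exact MeasurableSet.iInter fun i => (measurableSet_eq_fun
          ((measurable_pi_apply i).comp measurable_fst) measurable_snd).compl
      have h2 : ∀ᵐ z ∂((Measure.pi fun _ : Fin n => ν).prod ν), z.2 ∉ Set.range z.1 := by
        rw [Measure.ae_prod_iff_ae_ae hm]
        refine .of_forall fun z => ?_
        exact measure_eq_zero_iff_ae_notMem.1 ((Set.finite_range z).measure_zero ν)
      exact (Measure.measurePreserving_swap (μ := ν)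
        (ν := Measure.pi fun _ : Fin n => ν)).quasiMeasurePreserving.ae h2
    have hp := (measurePreserving_headTail ν n).quasiMeasurePreserving
    filter_upwards [hp.ae h1, hp.ae (Measure.quasiMeasurePreserving_snd.ae ih)] with y h2 h3
    rw [← Fin.cons_self_tail y, Fin.cons_injective_iff]
    exact ⟨h2, h3⟩

/-- The count of `{y}` is Poisson with parameter `ν {y} = 0`, so its mean vanishes. -/
theorem IsPoissonProcess.ae_apply_singleton_eq_zero [MeasurableSingletonClass X]
    [NullSingletonClass ν] (hQ : IsPoissonProcess ν Q id) (y : X) :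
    ∀ᵐ x : Config X ∂Q, x.1 {y} = 0 := by
  have h := hQ.lintegral_prod_counts (ι := Unit) (A := fun _ => {y})
    (fun _ => measurableSet_singleton y) (fun i j h => absurd (Subsingleton.elim i j) h)
    (f := fun _ z => z) (fun _ => measurable_id)
  have h2 := lintegral_id_mul_poissonMeasure 0 (fun _ => 1)
  simp only [mul_one, ENNReal.coe_zero, zero_mul] at h2
  simp only [Finset.univ_unique, Finset.prod_singleton, measure_singleton, ENNReal.toNNReal_zero,
    h2] at h
  exact (lintegral_eq_zero_iff (Config.measurable_apply (measurableSet_singleton y))).1 h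

theorem IsPoissonProcess.meanDiff_eq_zero [MeasurableEq X] [MeasurableSingletonClass X]
    [IsFiniteMeasure ν] [NullSingletonClass ν] (hQ : IsPoissonProcess ν Q id) {q n : ℕ}
    (hn : q < n) {F : Config X → ℝ} (hF : HasDegreeLE q F) :
    meanDiff Q id n F =ᵐ[Measure.pi fun _ : Fin n => ν] 0 := by
  filter_upwards [ae_injective_pi n] with y hy
  refine integral_eq_zero_of_ae ?_
  filter_upwards [ae_all_iff.2 fun i => hQ.ae_apply_singleton_eq_zero (y i)] with x hx
  exact hF.iterDiff_eq_zero hn hy fun i hi => Config.mem_support.1 hi (hx i)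

end PoissonFunctionals

/-! ### Return to a general sample space and the covariance formula -/

namespace PoissonFunctionals

variable {X : Type*} [MeasurableSpace X] {ν : Measure X}
  {Ω : Type*} [MeasurableSpace Ω] {P : Measure Ω} [IsProbabilityMeasure P] {η : Ω → Config X}

theorem IsPoissonProcess.isProbabilityMeasure_map (hη : IsPoissonProcess ν P η) :
    IsProbabilityMeasure (P.map η) :=
  Measure.isProbabilityMeasure_map hη.measurable.aemeasurable

variable [IsFiniteMeasure ν]

theorem IsPoissonProcess.ae_integrable_iterDiff_comp (hη : IsPoissonProcess ν P η) (n : ℕ)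
    {F : Config X → ℝ} (hF : MemLp F 2 (P.map η)) :
    ∀ᵐ y ∂(Measure.pi fun _ : Fin n => ν), Integrable (fun ω => iterDiff n y F (η ω)) P := by
  have := hη.isProbabilityMeasure_map
  filter_upwards [hη.law.ae_integrable_iterDiff n hF] with y hy
  exact hy.comp_measurable hη.measurable

theorem IsPoissonProcess.meanDiff_ae_eq (hη : IsPoissonProcess ν P η) (n : ℕ)
    {F : Config X → ℝ} (hF : MemLp F 2 (P.map η)) :
    meanDiff P η n F =ᵐ[Measure.pi fun _ : Fin n => ν] meanDiff (P.map η) id n F := by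
  have := hη.isProbabilityMeasure_map
  filter_upwards [hη.law.ae_integrable_iterDiff n hF] with y hy
  exact (integral_map hη.measurable.aemeasurable hy.1).symm

theorem IsPoissonProcess.memLp_meanDiff (hη : IsPoissonProcess ν P η) (n : ℕ)
    {F : Config X → ℝ} (hF : MemLp F 2 (P.map η)) :
    MemLp (meanDiff P η n F) 2 (Measure.pi fun _ : Fin n => ν) := by
  have := hη.isProbabilityMeasure_map
  exact ((hη.law.fock hF hF).1 n).ae_eq (hη.meanDiff_ae_eq n hF).symm

/-- The covariance formula: for a functional of finite degree, the Fock space expansion of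
`𝔼 F(η) G(η)` is a finite sum. -/
theorem IsPoissonProcess.integral_mul_eq_of_hasDegreeLE [MeasurableEq X]
    [MeasurableSingletonClass X] [NullSingletonClass ν] (hη : IsPoissonProcess ν P η)
    {F G : Config X → ℝ} (hF : MemLp F 2 (P.map η)) (hG : MemLp G 2 (P.map η)) {q : ℕ}
    (hdeg : HasDegreeLE q F) :
    ∫ x, F x * G x ∂(P.map η) = (∫ x, F x ∂(P.map η)) * (∫ x, G x ∂(P.map η)) +
      ∑ n ∈ Finset.Icc 1 q, (1 / (n.factorial : ℝ)) *
        ∫ y, meanDiff P η n F y * meanDiff P η n G y ∂(Measure.pi fun _ : Fin n => ν) := by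
  have := hη.isProbabilityMeasure_map
  have hsum := (hη.law.fock hF hG).2
  -- The series stops at `n = q`. Its term `n = 0` is split off: the empty product measure is a unit
  -- mass and `T₀` is the mean, so this term is the product of the two means.
  rw [← hsum.tsum_eq, tsum_eq_sum (s := Finset.range (q + 1)), Finset.range_eq_Ico,
    Finset.sum_eq_sum_Ico_succ_bot (by omega)]
  · congr 1
    · have h0 : ∀ (H : Config X → ℝ) (y : Fin 0 → X),
          meanDiff (P.map η) id 0 H y = ∫ x, H x ∂(P.map η) := fun _ _ => rfl
      simp [h0, Measure.pi_empty_univ, measureReal_def]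
    · refine Finset.sum_congr rfl fun n _ => ?_
      rw [one_div]
      congr 1
      refine integral_congr_ae ?_
      filter_upwards [hη.meanDiff_ae_eq n hF, hη.meanDiff_ae_eq n hG] with y h1 h2
      rw [h1, h2]
  · intro n hn
    have hn' : q < n := by simpa [Nat.lt_succ_iff] using hn
    rw [integral_eq_zero_of_ae, mul_zero]
    filter_upwards [hη.law.meanDiff_eq_zero hn' hdeg] with y hy
    simp [hy]

end PoissonFunctionals

/-! ### The theorem -/

theorem theorem1 {d : ℕ} (B : Set (EuclideanSpace ℝ (Fin d)))
    (hB : MeasurableSet B) (hBb : Bornology.IsBounded B) (hBpos : 0 < volume B)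
    (ν : Measure B) [IsFiniteMeasure ν] [NullSingletonClass ν]
    {Ω Ω' : Type*} [MeasurableSpace Ω] [MeasurableSpace Ω']
    (P : Measure Ω) [IsProbabilityMeasure P] (P' : Measure Ω') [IsProbabilityMeasure P']
    -- the Poisson process
    (η : Ω → PoissonFunctionals.Config B) (hη : PoissonFunctionals.IsPoissonProcess ν P η)
    -- the point process with density `p` with respect to the law of the Poisson process
    (p : PoissonFunctionals.Config B → ℝ) (hpm : Measurable p) (hp0 : ∀ x, 0 ≤ p x)
    (hp1 : ∫ x, p x ∂(P.map η) = 1)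
    (μ : Ω' → PoissonFunctionals.Config B) (hμ : Measurable μ)
    (hμp : P'.map μ = (P.map η).withDensity (fun x => ENNReal.ofReal (p x)))
    -- the `U`-statistics
    (m : ℕ) (k : Fin m → ℕ) (F : Fin m → PoissonFunctionals.Config B → ℝ)
    (hF : ∀ j, PoissonFunctionals.IsUStatistic ν (k j) (F j))
    (hF2 : MemLp (fun x => ∏ j, F j x) 2 (P.map η)) (hp2 : MemLp p 2 (P.map η)) :
    -- all expectations and scalar products in the formula are well defined
    Integrable (fun ω => ∏ j, F j (μ ω)) P' ∧
    Integrable (fun ω => ∏ j, F j (η ω)) P ∧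
    (∀ n ∈ Finset.Icc 1 (∑ j, k j),
      (∀ᵐ y ∂(Measure.pi fun _ : Fin n => ν),
        Integrable (fun ω =>
          PoissonFunctionals.iterDiff n y (fun x => ∏ j, F j x) (η ω)) P) ∧
      (∀ᵐ y ∂(Measure.pi fun _ : Fin n => ν),
        Integrable (fun ω => PoissonFunctionals.iterDiff n y p (η ω)) P) ∧
      MemLp (PoissonFunctionals.meanDiff P η n (fun x => ∏ j, F j x)) 2
        (Measure.pi fun _ : Fin n => ν) ∧
      MemLp (PoissonFunctionals.meanDiff P η n p) 2 (Measure.pi fun _ : Fin n => ν)) ∧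
    -- the formula
    ∫ ω, ∏ j, F j (μ ω) ∂P' = ∫ ω, ∏ j, F j (η ω) ∂P +
      ∑ n ∈ Finset.Icc 1 (∑ j, k j), (1 / (n.factorial : ℝ)) *
        ∫ y, PoissonFunctionals.meanDiff P η n (fun x => ∏ j, F j x) y *
          PoissonFunctionals.meanDiff P η n p y ∂(Measure.pi fun _ : Fin n => ν) := by
  have := hη.isProbabilityMeasure_map
  let G : PoissonFunctionals.Config B → ℝ := fun x => ∏ j, F j x
  have hG1 : Integrable G (P.map η) := hF2.integrable (by norm_num)
  have hGp : Integrable (fun x => G x * p x) (P.map η) := hF2.integrable_mul hp2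
  have hdens : ∀ x, (ENNReal.ofReal (p x)).toReal • G x = G x * p x := fun x => by
    rw [ENNReal.toReal_ofReal (hp0 x), smul_eq_mul, mul_comm]
  have hGμ : Integrable G (P'.map μ) := by
    rw [hμp, integrable_withDensity_iff_integrable_smul' hpm.ennreal_ofReal (by simp)]
    simpa only [hdens] using hGp
  refine ⟨hGμ.comp_measurable hμ, hG1.comp_measurable hη.measurable, fun n _ =>
    ⟨hη.ae_integrable_iterDiff_comp n hF2, hη.ae_integrable_iterDiff_comp n hp2,
      hη.memLp_meanDiff n hF2, hη.memLp_meanDiff n hp2⟩, ?_⟩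
  have hdeg := PoissonFunctionals.HasDegreeLE.prod Finset.univ fun j _ => (hF j).hasDegreeLE
  have hmain := hη.integral_mul_eq_of_hasDegreeLE hF2 hp2 hdeg
  rw [hp1, mul_one] at hmain
  have h1 : ∫ ω, ∏ j, F j (μ ω) ∂P' = ∫ x, G x * p x ∂(P.map η) := by
    rw [← integral_map (f := G) hμ.aemeasurable hGμ.1, hμp,
      integral_withDensity_eq_integral_toReal_smul hpm.ennreal_ofReal (by simp)]
    simp only [hdens]
  have h2 : ∫ ω, ∏ j, F j (η ω) ∂P = ∫ x, G x ∂(P.map η) :=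
    (integral_map (f := G) hη.measurable.aemeasurable hG1.1).symm
  rw [h1, h2]
  exact hmain
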